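/- Let $\alpha\ge 0$ and $h>0$. Put $Y=(0,\infty)^2$ with points $(s,t)$, $X=\mathbb R^2$ with points $x=(x_1,x_2)$, and $$A=A(s,x)=\sqrt{(x_1-\alpha s)^2+x_2^2+h^2},\qquad B=B(s,x)=\sqrt{(x_1-s)^2+x_2^2+h^2}.$$ Let $f\in C_c^\infty(\mathbb R^2)$ be a cutoff function of $(s,t)$ whose support lies in $\{(s,t): s>0,\ t>\sqrt{(\alpha-1)^2s^2+4h^2}\}$, let $a_0(s,t,x,\omega)$ be a function such that $a=f\cdot a_0$ is a symbol in $S^2$, i.e. $a$ is smooth on $Y\times X\times\mathbb R$ and for every compact $K\subset Y\times X$ and all multi-indices there is a constant $c$ with $$|\partial_\omega^{\delta}\partial_{s}^{\beta_1}\partial_t^{\beta_2}\partial_x^{\lambda}a(s,t,x,\omega)|\le c\,(1+|\omega|)^{2-\delta},\qquad (s,t,x)\in K,\ \omega\in\mathbb R$$ (in the radar model $a_0=\omega^2p(\omega)/(16\pi^2AB)$ with $p$ the transmitted waveform). Consider the bistatic SAR forward operator $$\mathcal F V(s,t)=\int e^{-i\omega(t-A(s,x)-B(s,x))}\,a(s,t,x,\omega)\,V(x)\,dx\,d\omega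 ,$$ understood as an oscillatory integral (a distribution on $Y$ for each test function $V$ on $X$). Then: 1. $\mathcal F$ is well defined and is a Fourier integral operator of order $3/2$ associated with the canonical relation $\mathcal C$ of item 2; that is, $\mathcal C$ is a homogeneous canonical relation and the Schwartz kernel of $\mathcal F$ is a Lagrangian distribution in $I^{3/2}(Y\times X;\mathcal C')$, where $\mathcal C'=\{(y,x;\eta,-\xi):(y,\eta;x,\xi)\in\mathcal C\}$. 2. The canonical relation $\mathcal C=\{(s,t,\partial_{s,t}\varphi;\,x,-\partial_x\varphi):\partial_\omega\varphi=0\}$ of the phase $\varphi=-\omega(t-A-B)$, for $s>0$, $t>\sqrt{(\alpha-1)^2s^2+4h^2}$, $x\in\mathbb R^2$, $\omega\ne0$, is contained in $(T^*Y\setminus\mathbf 0)\times(T^*X\setminus\mathbf 0)$ and equals $$\mathcal C=\Big\{\Big(s,t,-\omega\Big(\alpha\frac{x_1-\alpha s}{A}+\frac{x_1-s}{B}\Big),-\omega;\ x_1,x_2,-\omega\Big(\frac{x_1-\alpha s}{A}+\frac{x_1-s}{B}\Big),-\omega\Big(\frac{x_2}{A}+\frac{x_2}{B}\Big)\Big):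 s>0,\ \omega\ne0,\ t=A+B,\ x\ne\Big(\frac{(\alpha+1)s}{2},0\Big)\Big\}.$$ Moreover $(s,x_1,x_2,\omega)$, ranging over $\{s>0,\ \omega\neq0,\ x\ne((\alpha+1)s/2,0)\}$, is a global smooth parametrization of $\mathcal C$ (an immersion that is a homeomorphism onto $\mathcal C$). 3. Let $\pi_L:\mathcal C\to T^*Y\setminus\mathbf 0$ and $\pi_R:\mathcal C\to T^*X\setminus\mathbf 0$ be the projections. Both drop rank by one simply exactly on $\Sigma_1=\{(s,x_1,x_2,\omega)\in\mathcal C: x_2=0\}$: for $\pi=\pi_L,\pi_R$ the zero set of $\det d\pi$ is $\Sigma_1$, and at every point of $\Sigma_1$ one has $\operatorname{rank}d\pi=3$ and $d(\det d\pi)\ne0$. 4. $\pi_L$ has a Whitney fold along $\Sigma_1$ and $\pi_R$ has a blowdown singularity along $\Sigma_1$: both are local diffeomorphisms away from $\Sigma_1$ and drop rank by one simply on $\Sigma_1$, and at every point of $\Sigma_1$ one has $\ker d\pi_L\not\subset T\Sigma_1$ and $\ker d\pi_R\subset T\Sigma_1$. -/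

import Mathlib

open Set Filter TopologicalSpace MeasureTheory
open scoped ContDiff Topology Distributions Manifold

noncomputable section

/-! ### Smooth maps dropping rank simply, Whitney folds, blowdowns -/

section Singularities

variable {E F : Type*} [NormedAddCommGroup E] [NormedSpace ℝ E]
  [NormedAddCommGroup F] [NormedSpace ℝ F]

/-- The Jacobian determinant of `f : E → F` at `q`, computed after identifying the target with the
source through the linear isomorphism `L`. Another choice of `L` multiplies it by a nonzero
constant. -/
def jacobianDet (L : F ≃L[ℝ] E) (f : E → F) (q : E) : ℝ :=
  ((L : F →L[ℝ] E).comp (fderiv ℝ f q)).det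

/-- `f`, defined on the open set `D`, drops rank by one simply on `S`: the set of points of `D`
where `det df = 0` is exactly `S`, and at each point of `S` the rank of `df` is `dim - 1` and
`d (det df) ≠ 0`. (None of this depends on the choice of `L`.) -/
def DropsRankByOneSimply (f : E → F) (D S : Set E) : Prop :=
  ∃ L : F ≃L[ℝ] E,
    S = {q ∈ D | jacobianDet L f q = 0} ∧
    ∀ q ∈ S, Module.finrank ℝ (LinearMap.range (fderiv ℝ f q).toLinearMap) + 1
        = Module.finrank ℝ E ∧
      fderiv ℝ (jacobianDet L f) q ≠ 0

/-- The tangent vectors to `S` at `q`: velocities at `q` of curves in `S` through `q`. -/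
def tangentVectors (S : Set E) (q : E) : Set E :=
  {v | ∃ c : ℝ → E, c 0 = q ∧ HasDerivAt c v 0 ∧ ∀ᶠ r in 𝓝 (0 : ℝ), c r ∈ S}

/-- `f : D → F` has a Whitney fold along `S`. -/
structure HasWhitneyFold (f : E → F) (D S : Set E) : Prop where
  isOpen : IsOpen D
  smooth : ContDiffOn ℝ ∞ f D
  localDiffeo : ∀ q ∈ D \ S, IsLocalDiffeomorphAt 𝓘(ℝ, E) 𝓘(ℝ, F) ∞ f q
  dropsRank : DropsRankByOneSimply f D S
  ker_not_subset : ∀ q ∈ S,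
    ¬ {v : E | fderiv ℝ f q v = 0} ⊆ tangentVectors S q

/-- `f : D → F` has a blowdown singularity along `S`. -/
structure HasBlowdown (f : E → F) (D S : Set E) : Prop where
  isOpen : IsOpen D
  smooth : ContDiffOn ℝ ∞ f D
  localDiffeo : ∀ q ∈ D \ S, IsLocalDiffeomorphAt 𝓘(ℝ, E) 𝓘(ℝ, F) ∞ f q
  dropsRank : DropsRankByOneSimply f D S
  ker_subset : ∀ q ∈ S,
    {v : E | fderiv ℝ f q v = 0} ⊆ tangentVectors S q

/-- `Ψ : D → S` is a smooth parametrization of `S` by the open set `D`: a smooth immersion that is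
a homeomorphism of `D` onto `S`. -/
structure IsSmoothParametrization (Ψ : E → F) (D : Set E) (S : Set F) : Prop where
  isOpen : IsOpen D
  smooth : ContDiffOn ℝ ∞ Ψ D
  immersion : ∀ q ∈ D, Function.Injective (fderiv ℝ Ψ q)
  isEmbedding : Topology.IsEmbedding (D.domRestrict Ψ)
  image_eq : Ψ '' D = S

end Singularities

/-! ### Symbols -/

/-- The symbol class `S^μ(Z × ℝ^N)` of type `(1,0)`: `a` is smooth on `Z × ℝ^N`, and over each
compact subset of `Z` all derivatives of order `j` in `z` and order `k` in `θ` are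
`O((1 + |θ|)^(μ - k))`. -/
def IsSymbol {E : Type*} [NormedAddCommGroup E] [NormedSpace ℝ E] {N : ℕ}
    (Z : Set E) (μ : ℝ) (a : E × (Fin N → ℝ) → ℂ) : Prop :=
  ContDiffOn ℝ ∞ a (Z ×ˢ univ) ∧
  ∀ K ⊆ Z, IsCompact K → ∀ j k : ℕ, ∃ c : ℝ, ∀ z ∈ K, ∀ θ : Fin N → ℝ,
    ‖iteratedFDeriv ℝ j (fun z' => iteratedFDeriv ℝ k (fun θ' => a (z', θ')) θ) z‖
      ≤ c * (1 + ‖θ‖) ^ (μ - k)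

/-! ### Phase functions and canonical relations

Points of `T*ℝⁿ` are pairs `(x, ξ)` of coordinate vectors, and a point of `T*ℝᵐ × T*ℝⁿ` is
written `((y, η), (x, ξ))`. -/

/-- `T*ℝⁿ` in coordinates. -/
abbrev Cotangent (n : ℕ) : Type := (Fin n → ℝ) × (Fin n → ℝ)

/-- The space of `((y, x), θ)` with `y ∈ ℝᵐ`, `x ∈ ℝⁿ`, `θ ∈ ℝᴺ`. -/
abbrev PhaseDomain (m n N : ℕ) : Type := ((Fin m → ℝ) × (Fin n → ℝ)) × (Fin N → ℝ)

section Fourier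

variable {m n N : ℕ}

/-- `∂φ/∂y`. -/
def gradY (φ : PhaseDomain m n N → ℝ) (p : PhaseDomain m n N) : Fin m → ℝ :=
  fun i => fderiv ℝ φ p ((Pi.single i 1, 0), 0)

/-- `∂φ/∂x`. -/
def gradX (φ : PhaseDomain m n N → ℝ) (p : PhaseDomain m n N) : Fin n → ℝ :=
  fun i => fderiv ℝ φ p ((0, Pi.single i 1), 0)

/-- `∂φ/∂θ`. -/
def gradTheta (φ : PhaseDomain m n N → ℝ) (p : PhaseDomain m n N) : Fin N → ℝ :=
  fun i => fderiv ℝ φ p (0, Pi.single i 1)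

/-- The critical set `{p ∈ U : ∂φ/∂θ = 0}`. -/
def criticalSet (φ : PhaseDomain m n N → ℝ) (U : Set (PhaseDomain m n N)) :
    Set (PhaseDomain m n N) :=
  {p ∈ U | gradTheta φ p = 0}

/-- `(y, x, θ) ↦ ((y, ∂φ/∂y), (x, -∂φ/∂x))`. -/
def relationMap (φ : PhaseDomain m n N → ℝ) (p : PhaseDomain m n N) : Cotangent m × Cotangent n :=
  ((p.1.1, gradY φ p), (p.1.2, -gradX φ p))

/-- The canonical relation
`{((y, ∂φ/∂y), (x, -∂φ/∂x)) : (y, x, θ) ∈ U, ∂φ/∂θ = 0}` of the phase function `φ` on `U`. -/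
def phaseRelation (φ : PhaseDomain m n N → ℝ) (U : Set (PhaseDomain m n N)) :
    Set (Cotangent m × Cotangent n) :=
  relationMap φ '' criticalSet φ U

/-- `φ` is a non-degenerate phase function on the open cone `U`. -/
structure IsNondegeneratePhase (φ : PhaseDomain m n N → ℝ) (U : Set (PhaseDomain m n N)) :
    Prop where
  isOpen : IsOpen U
  theta_ne_zero : ∀ p ∈ U, p.2 ≠ 0
  conic : ∀ p ∈ U, ∀ r : ℝ, 0 < r → (p.1, r • p.2) ∈ U
  smooth : ContDiffOn ℝ ∞ φ U
  homogeneous : ∀ p ∈ U, ∀ r : ℝ, 0 < r → φ (p.1, r • p.2) = r * φ p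
  fderiv_ne_zero : ∀ p ∈ U, fderiv ℝ φ p ≠ 0
  linearIndependent : ∀ p ∈ criticalSet φ U,
    LinearIndependent ℝ (fun k : Fin N => fderiv ℝ (fun q => gradTheta φ q k) p)

/-- The non-degenerate phase `φ` on `U` defines an open piece of `C`. -/
def DefinesOpenPiece (φ : PhaseDomain m n N → ℝ) (U : Set (PhaseDomain m n N))
    (C : Set (Cotangent m × Cotangent n)) : Prop :=
  InjOn (relationMap φ) (criticalSet φ U) ∧
  ∃ O : Set (Cotangent m × Cotangent n), IsOpen O ∧ phaseRelation φ U = C ∩ O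

/-- `(T*Y \ 0) × (T*X \ 0)`. -/
def puncturedCotangentProd (Y : Opens (Fin m → ℝ)) (X : Opens (Fin n → ℝ)) :
    Set (Cotangent m × Cotangent n) :=
  {c | c.1.1 ∈ Y ∧ c.1.2 ≠ 0 ∧ c.2.1 ∈ X ∧ c.2.2 ≠ 0}

/-- The standard symplectic form `dξ ∧ dx` on `T*ℝⁿ`. -/
def symplecticForm (v w : Cotangent n) : ℝ := v.2 ⬝ᵥ w.1 - w.2 ⬝ᵥ v.1

/-- `C` is a homogeneous canonical relation from `T*X \ 0` to `T*Y \ 0`: a conic, relatively closed,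
embedded submanifold of `(T*Y \ 0) × (T*X \ 0)` of dimension `dim Y + dim X` that is Lagrangian for
the difference `σ_Y - σ_X` of the symplectic forms. -/
structure IsCanonicalRelation (Y : Opens (Fin m → ℝ)) (X : Opens (Fin n → ℝ))
    (C : Set (Cotangent m × Cotangent n)) : Prop where
  subset : C ⊆ puncturedCotangentProd Y X
  closed : closure C ∩ puncturedCotangentProd Y X ⊆ C
  conic : ∀ c ∈ C, ∀ r : ℝ, 0 < r → ((c.1.1, r • c.1.2), (c.2.1, r • c.2.2)) ∈ C
  lagrangian : ∀ c ∈ C, ∃ (Ψ : (Fin (m + n) → ℝ) → Cotangent m × Cotangent n)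
    (D : Set (Fin (m + n) → ℝ)) (O : Set (Cotangent m × Cotangent n)),
    IsOpen O ∧ c ∈ O ∧ IsSmoothParametrization Ψ D (C ∩ O) ∧
    ∀ q ∈ D, ∀ v w : Fin (m + n) → ℝ,
      symplecticForm (fderiv ℝ Ψ q v).1 (fderiv ℝ Ψ q w).1
        = symplecticForm (fderiv ℝ Ψ q v).2 (fderiv ℝ Ψ q w).2

/-! ### Oscillatory integrals and Fourier integral operators -/

/-- The product `Y × X` of two open sets. -/
def prodOpens (Y : Opens (Fin m → ℝ)) (X : Opens (Fin n → ℝ)) :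
    Opens ((Fin m → ℝ) × (Fin n → ℝ)) :=
  ⟨(Y : Set (Fin m → ℝ)) ×ˢ (X : Set (Fin n → ℝ)), Y.isOpen.prod X.isOpen⟩

/-- `χ` is a smooth, compactly supported function on `ℝᴺ` that is `1` near the origin. -/
def IsFrequencyCutoff (χ : (Fin N → ℝ) → ℝ) : Prop :=
  ContDiff ℝ ∞ χ ∧ HasCompactSupport χ ∧ ∀ᶠ θ in 𝓝 0, χ θ = 1

/-- The regularized integral `∫∫∫ exp(i φ(y,x,θ)) a(y,x,θ) χ(ε θ) w(y,x) dy dx dθ`. -/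
def regularizedIntegral (φ : PhaseDomain m n N → ℝ) (a : PhaseDomain m n N → ℂ)
    (χ : (Fin N → ℝ) → ℝ) (w : (Fin m → ℝ) × (Fin n → ℝ) → ℝ) (ε : ℝ) : ℂ :=
  ∫ p : PhaseDomain m n N,
    Complex.exp (Complex.I * (φ p : ℂ)) * a p * (χ (ε • p.2) : ℂ) * (w p.1 : ℂ)

/-- The distribution `T` on `Z ⊆ ℝᵐ × ℝⁿ` is the oscillatory integral
`∫ exp(i φ(y,x,θ)) a(y,x,θ) dθ`. -/
def IsOscillatoryIntegral (φ : PhaseDomain m n N → ℝ) (a : PhaseDomain m n N → ℂ)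
    {Z : Opens ((Fin m → ℝ) × (Fin n → ℝ))} (T : 𝓓'(Z, ℂ)) : Prop :=
  ∀ (w : 𝓓(Z, ℝ)) (χ : (Fin N → ℝ) → ℝ), IsFrequencyCutoff χ →
    Tendsto (regularizedIntegral φ a χ w) (𝓝[>] 0) (𝓝 (T w))

/-- `A` is the operator `A V(y) = ∫∫ exp(i φ(y,x,θ)) a(y,x,θ) V(x) dx dθ`, the integral being an
oscillatory integral: for test functions `V` on `X` and `u` on `Y`, `⟨A V, u⟩` is the limit of the
regularized integrals of `exp(i φ) a V(x) u(y)`. -/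
def IsOscillatoryIntegralOperator (φ : PhaseDomain m n N → ℝ) (a : PhaseDomain m n N → ℂ)
    {Y : Opens (Fin m → ℝ)} {X : Opens (Fin n → ℝ)} (A : 𝓓(X, ℝ) →ₗ[ℝ] 𝓓'(Y, ℂ)) : Prop :=
  ∀ (V : 𝓓(X, ℝ)) (u : 𝓓(Y, ℝ)) (χ : (Fin N → ℝ) → ℝ), IsFrequencyCutoff χ →
    Tendsto (regularizedIntegral φ a χ (fun z => u z.1 * V z.2)) (𝓝[>] 0) (𝓝 (A V u))

/-- `a` is supported in a closed cone in the `θ` variable that has a compact base in `U`. -/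
def HasConicSupportWithCompactBase (a : PhaseDomain m n N → ℂ) (U : Set (PhaseDomain m n N)) :
    Prop :=
  ∃ B ⊆ U, IsCompact B ∧ ∀ p, a p ≠ 0 → ∃ b ∈ B, ∃ r : ℝ, 0 ≤ r ∧ p = (b.1, r • b.2)

/-- `K ∈ I^μ(Y × X; C')`, where `C' = {(y, x; η, -ξ) : (y, η; x, ξ) ∈ C}`: the distribution `K` is
a sum, with locally finite supports, of oscillatory integrals with non-degenerate phase functions
`φⱼ(y, x, θ)`, `θ ∈ ℝ^{Nⱼ}`, that define open pieces of `C`, and with amplitudes `aⱼ` of order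
`μ + (dim Y + dim X)/4 - Nⱼ/2` supported in cones with compact base. -/
def IsLagrangianDistribution (Y : Opens (Fin m → ℝ)) (X : Opens (Fin n → ℝ)) (μ : ℝ)
    (C : Set (Cotangent m × Cotangent n)) (K : 𝓓'(prodOpens Y X, ℂ)) : Prop :=
  ∃ (N : ℕ → ℕ) (φ : ∀ j, PhaseDomain m n (N j) → ℝ) (a : ∀ j, PhaseDomain m n (N j) → ℂ)
    (U : ∀ j, Set (PhaseDomain m n (N j))) (T : ℕ → 𝓓'(prodOpens Y X, ℂ)),
    (∀ j,
      (∀ p ∈ U j, p.1 ∈ prodOpens Y X) ∧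
      IsNondegeneratePhase (φ j) (U j) ∧
      DefinesOpenPiece (φ j) (U j) C ∧
      IsSymbol (prodOpens Y X : Set _) (μ + ((m : ℝ) + n) / 4 - (N j : ℝ) / 2) (a j) ∧
      HasConicSupportWithCompactBase (a j) (U j) ∧
      IsOscillatoryIntegral (φ j) (a j) (T j)) ∧
    (∀ Q ⊆ (prodOpens Y X : Set _), IsCompact Q →
      {j | ∃ w : 𝓓(prodOpens Y X, ℝ), tsupport w ⊆ Q ∧ T j w ≠ 0}.Finite) ∧
    ∀ w : 𝓓(prodOpens Y X, ℝ), K w = ∑ᶠ j, T j w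

/-- `A` is a Fourier integral operator of order `μ` associated with the canonical relation `C`:
its Schwartz kernel belongs to `I^μ(Y × X; C')`. -/
def IsFourierIntegralOperator {Y : Opens (Fin m → ℝ)} {X : Opens (Fin n → ℝ)} (μ : ℝ)
    (C : Set (Cotangent m × Cotangent n)) (A : 𝓓(X, ℝ) →ₗ[ℝ] 𝓓'(Y, ℂ)) : Prop :=
  IsCanonicalRelation Y X C ∧
  ∃ K : 𝓓'(prodOpens Y X, ℂ), IsLagrangianDistribution Y X μ C K ∧
    ∀ (V : 𝓓(X, ℝ)) (u : 𝓓(Y, ℝ)) (w : 𝓓(prodOpens Y X, ℝ)),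
      (∀ y x, w (y, x) = u y * V x) → K w = A V u

end Fourier

/-! ### The bistatic SAR transform

The data space has points `y = (s, t) = (y 0, y 1)`, the ground has points
`x = (x₁, x₂) = (x 0, x 1)`, and the frequency is `ω = θ 0`. -/

namespace SAR

/-- `A(s, x)`, the distance from the transmitter `(α s, 0, h)` to `(x₁, x₂, 0)`. -/
def distT (α h s : ℝ) (x : Fin 2 → ℝ) : ℝ := √((x 0 - α * s) ^ 2 + x 1 ^ 2 + h ^ 2)

/-- `B(s, x)`, the distance from the receiver `(s, 0, h)` to `(x₁, x₂, 0)`. -/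
def distR (h s : ℝ) (x : Fin 2 → ℝ) : ℝ := √((x 0 - s) ^ 2 + x 1 ^ 2 + h ^ 2)

/-- The data space `Y = (0,∞)²`. -/
def dataSpace : Opens (Fin 2 → ℝ) :=
  ⟨{y | 0 < y 0 ∧ 0 < y 1},
    (isOpen_lt continuous_const (continuous_apply 0)).inter
      (isOpen_lt continuous_const (continuous_apply 1))⟩

/-- The object space `X = ℝ²`. -/
def objectSpace : Opens (Fin 2 → ℝ) := ⊤

/-- The `(s, t)` with `s > 0` and `t > √((α - 1)² s² + 4 h²)`. -/
def signalRegion (α h : ℝ) : Set (Fin 2 → ℝ) :=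
  {y | 0 < y 0 ∧ √((α - 1) ^ 2 * y 0 ^ 2 + 4 * h ^ 2) < y 1}

/-- The smooth cutoff functions `f(s, t)` with compact support in the signal region. -/
structure IsDataCutoff (α h : ℝ) (f : (Fin 2 → ℝ) → ℝ) : Prop where
  smooth : ContDiff ℝ ∞ f
  hasCompactSupport : HasCompactSupport f
  tsupport_subset : tsupport f ⊆ signalRegion α h

/-- The phase `φ = -ω (t - A(s, x) - B(s, x))`. -/
def phase (α h : ℝ) (p : PhaseDomain 2 2 1) : ℝ :=
  -(p.2 0) * (p.1.1 1 - distT α h (p.1.1 0) p.1.2 - distR h (p.1.1 0) p.1.2)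

/-- The amplitude `a = f a₀`. -/
def amplitude (f : (Fin 2 → ℝ) → ℝ) (a₀ : PhaseDomain 2 2 1 → ℂ) (p : PhaseDomain 2 2 1) : ℂ :=
  (f p.1.1 : ℂ) * a₀ p

/-- The set of `(s, t, x, ω)` with `(s, t)` in the signal region and `ω ≠ 0`. -/
def phaseCone (α h : ℝ) : Set (PhaseDomain 2 2 1) :=
  {p | p.1.1 ∈ signalRegion α h ∧ p.2 ≠ 0}

/-- For the frequency `w = ω`, the point `((s, t, σ, τ), (x₁, x₂, ξ₁, ξ₂))` with `t = A + B`,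
`σ = -ω (α (x₁ - α s)/A + (x₁ - s)/B)`, `τ = -ω`,
`ξ₁ = -ω ((x₁ - α s)/A + (x₁ - s)/B)`, `ξ₂ = -ω (x₂/A + x₂/B)`. -/
def relationPoint (α h s : ℝ) (x : Fin 2 → ℝ) (w : ℝ) : Cotangent 2 × Cotangent 2 :=
  ((![s, distT α h s x + distR h s x],
    ![-w * (α * ((x 0 - α * s) / distT α h s x) + (x 0 - s) / distR h s x), -w]),
   (![x 0, x 1],
    ![-w * ((x 0 - α * s) / distT α h s x + (x 0 - s) / distR h s x),
      -w * (x 1 / distT α h s x + x 1 / distR h s x)]))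

/-- The parameters `(s, x₁, x₂, ω)` with `s > 0`, `ω ≠ 0`, and `(x₁, x₂)` not the ground point
`((α + 1) s / 2, 0)` midway between transmitter and receiver. -/
def paramDomain (α : ℝ) : Set (Fin 4 → ℝ) :=
  {q | 0 < q 0 ∧ q 3 ≠ 0 ∧ ¬ (q 1 = (α + 1) * q 0 / 2 ∧ q 2 = 0)}

/-- The map `(s, x₁, x₂, ω) ↦ ((s, t, σ, τ), (x₁, x₂, ξ₁, ξ₂))`. -/
def param (α h : ℝ) (q : Fin 4 → ℝ) : Cotangent 2 × Cotangent 2 :=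
  relationPoint α h (q 0) ![q 1, q 2] (q 3)

/-- The canonical relation of the transform. -/
def relation (α h : ℝ) : Set (Cotangent 2 × Cotangent 2) :=
  {c | ∃ (s : ℝ) (x : Fin 2 → ℝ) (w : ℝ), 0 < s ∧ w ≠ 0 ∧
    ¬ (x 0 = (α + 1) * s / 2 ∧ x 1 = 0) ∧ c = relationPoint α h s x w}

/-- The left projection to `T*Y`, in the coordinates `(s, x₁, x₂, ω)` of the canonical relation. -/
def projL (α h : ℝ) (q : Fin 4 → ℝ) : Cotangent 2 := (param α h q).1

/-- The right projection to `T*X`, in the coordinates `(s, x₁, x₂, ω)` of the canonical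
relation. -/
def projR (α h : ℝ) (q : Fin 4 → ℝ) : Cotangent 2 := (param α h q).2

/-- `Σ₁ = {x₂ = 0}`, in the coordinates `(s, x₁, x₂, ω)` of the canonical relation. -/
def sigmaOne (α : ℝ) : Set (Fin 4 → ℝ) := {q ∈ paramDomain α | q 2 = 0}

end SAR

end

noncomputable section

/-! ### Derivatives of distances -/

section Radius

variable {E : Type*} [NormedAddCommGroup E] [NormedSpace ℝ E] {h : ℝ} {u v : E → ℝ}
  {u' v' : E →L[ℝ] ℝ} {x : E}

/-! The microlocal geometry is explicit. Write `a`, `b` for the `x₁`-derivatives of `A`, `B`; since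
`h > 0`, both lie in `(-1, 1)`. In the coordinates `(s, x₁, x₂, ω)` each projection has two
coordinate rows (`s` and `τ = -ω` on the left, `x₁` and `x₂` on the right), so its Jacobian is a two
by two minor. Both minors equal `-x₂ ω W`, where `W = (α/A² + 1/B²)(1 + ab) + (α(1 - a²) + (1 -
b²))/(AB)` is positive because `α ≥ 0` (`weight_pos`, `jacobianDet_projL`, `jacobianDet_projR`).
Hence the determinant vanishes simply, exactly on `x₂ = 0`. There the ranges are even in `x₂`, so
`ker dπ_L` is the line of `∂/∂x₂`, transverse to `Σ₁`, while `ker dπ_R` lies in the `(s, ω)` plane,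
tangent to `Σ₁`: a fold and a blowdown.

The excluded midpoint has two meanings that must agree. It is the only ground point where `A + B`
attains its lower bound `√((α - 1)² s² + 4h²)` (`sqrt_lt_radius_add_radius_iff`), so the signal
region removes exactly it from the critical set; and it is the only point where `ξ = 0`
(`slope_add_slope_eq_zero`), so removing it keeps the relation off the zero section, and nothing
else is missing from its closure.

For the operator, the phase is linear in `t` with slope `-ω`, whence `exp(iφ) = (1 - iω)⁻¹ (1 + ∂ₜ)
exp(iφ)`. Four integrations by parts turn an amplitude of order 2 into one of order -2, which is
absolutely integrable in the single frequency variable. Dominated convergence then gives the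
oscillatory integral (`tendsto_regularizedIntegral`), and the same majorant makes it a distribution
on `Y × X`, whose pairings with `u ⊗ V` define the operator. The phase is non-degenerate and
parametrizes the whole relation, so a single phase function suffices. The cutoff `f` gives compact
support in `(s, t)` only; a decomposition into shells in `x` provides the compact bases required of
a Lagrangian distribution (`isLagrangianDistribution_of_isOscillatoryIntegral`). -/

lemma sqrt_radius_pos (hh : 0 < h) (a b : ℝ) : 0 < √(a ^ 2 + b ^ 2 + h ^ 2) :=
  Real.sqrt_pos.2 (by positivity)

lemma sq_sqrt_radius (h a b : ℝ) : √(a ^ 2 + b ^ 2 + h ^ 2) ^ 2 = a ^ 2 + b ^ 2 + h ^ 2 :=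
  Real.sq_sqrt (by positivity)

lemma HasFDerivAt.sqrt_radius (hh : 0 < h) (hu : HasFDerivAt u u' x) (hv : HasFDerivAt v v' x) :
    HasFDerivAt (fun y => √(u y ^ 2 + v y ^ 2 + h ^ 2))
      ((u x / √(u x ^ 2 + v x ^ 2 + h ^ 2)) • u' + (v x / √(u x ^ 2 + v x ^ 2 + h ^ 2)) • v') x := by
  have h0 : u x ^ 2 + v x ^ 2 + h ^ 2 ≠ 0 := by positivity
  have hr := (sqrt_radius_pos hh (u x) (v x)).ne'
  refine ((((hu.pow 2).add (hv.pow 2)).add_const (h ^ 2)).sqrt h0).congr_fderiv ?_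
  ext w
  simp
  field_simp

lemma HasFDerivAt.div_sqrt_radius (hh : 0 < h) (hu : HasFDerivAt u u' x)
    (hv : HasFDerivAt v v' x) :
    HasFDerivAt (fun y => u y / √(u y ^ 2 + v y ^ 2 + h ^ 2))
      (((1 - (u x / √(u x ^ 2 + v x ^ 2 + h ^ 2)) ^ 2) / √(u x ^ 2 + v x ^ 2 + h ^ 2)) • u'
        - (u x / √(u x ^ 2 + v x ^ 2 + h ^ 2) * (v x / √(u x ^ 2 + v x ^ 2 + h ^ 2))
            / √(u x ^ 2 + v x ^ 2 + h ^ 2)) • v') x := by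
  have hr := (sqrt_radius_pos hh (u x) (v x)).ne'
  simp only [div_eq_mul_inv (u _)]
  refine (hu.mul ((hasDerivAt_inv hr).comp_hasFDerivAt x (hu.sqrt_radius hh hv))).congr_fderiv ?_
  ext w
  simp
  field_simp
  ring

end Radius

/-! ### Ranges, their first derivatives, and the differential of the parametrization. -/

namespace SAR

/-- The distance from `(c s, 0, h)` to `(x₁, x₂, 0)` at `q = (s, x₁, x₂, ω)`. -/
def radius (c h : ℝ) (q : Fin 4 → ℝ) : ℝ := √((q 1 - c * q 0) ^ 2 + q 2 ^ 2 + h ^ 2)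

/-- The derivative of `radius` in `x₁`. -/
def slope (c h : ℝ) (q : Fin 4 → ℝ) : ℝ := (q 1 - c * q 0) / radius c h q

/-- The derivative of `radius` in `x₂`. -/
def tilt (c h : ℝ) (q : Fin 4 → ℝ) : ℝ := q 2 / radius c h q

variable {α c h : ℝ} {q : Fin 4 → ℝ}

lemma radius_pos (hh : 0 < h) (c : ℝ) (q : Fin 4 → ℝ) : 0 < radius c h q := sqrt_radius_pos hh _ _

lemma sq_radius (c h : ℝ) (q : Fin 4 → ℝ) :
    radius c h q ^ 2 = (q 1 - c * q 0) ^ 2 + q 2 ^ 2 + h ^ 2 := sq_sqrt_radius _ _ _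

lemma slope_sq_lt_one (hh : 0 < h) (c : ℝ) (q : Fin 4 → ℝ) : slope c h q ^ 2 < 1 := by
  rw [slope, div_pow, div_lt_one (pow_pos (radius_pos hh c q) 2), sq_radius]
  nlinarith [sq_nonneg (q 2), pow_pos hh 2]

/-- The first coordinate of the vector from transmitter to target, as a linear form. -/
def offset (c : ℝ) : (Fin 4 → ℝ) →L[ℝ] ℝ :=
  ContinuousLinearMap.proj 1 - c • ContinuousLinearMap.proj 0

@[simp] lemma offset_apply (c : ℝ) (v : Fin 4 → ℝ) : offset c v = v 1 - c * v 0 := by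
  simp [offset]

lemma hasFDerivAt_offset (c : ℝ) (q : Fin 4 → ℝ) :
    HasFDerivAt (fun q : Fin 4 → ℝ => q 1 - c * q 0) (offset c) q :=
  (hasFDerivAt_apply 1 q).sub ((hasFDerivAt_apply 0 q).const_mul c)

lemma hasFDerivAt_radius (hh : 0 < h) (c : ℝ) (q : Fin 4 → ℝ) :
    HasFDerivAt (radius c h)
      (slope c h q • offset c + tilt c h q • ContinuousLinearMap.proj 2) q := by
  have hu := hasFDerivAt_offset c q
  have hv := hasFDerivAt_apply (𝕜 := ℝ) 2 q
  exact hu.sqrt_radius hh hv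

lemma hasFDerivAt_slope (hh : 0 < h) (c : ℝ) (q : Fin 4 → ℝ) :
    HasFDerivAt (slope c h) (((1 - slope c h q ^ 2) / radius c h q) • offset c
      - (slope c h q * tilt c h q / radius c h q) • ContinuousLinearMap.proj 2) q := by
  have hu := hasFDerivAt_offset c q
  have hv := hasFDerivAt_apply (𝕜 := ℝ) 2 q
  exact hu.div_sqrt_radius hh hv

lemma hasFDerivAt_tilt (hh : 0 < h) (c : ℝ) (q : Fin 4 → ℝ) :
    HasFDerivAt (tilt c h) (((1 - tilt c h q ^ 2) / radius c h q) • ContinuousLinearMap.proj 2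
      - (slope c h q * tilt c h q / radius c h q) • offset c) q := by
  have hu := hasFDerivAt_offset c q
  have hv := hasFDerivAt_apply (𝕜 := ℝ) 2 q
  have key := hv.div_sqrt_radius hh hu
  -- The radius is symmetric in the two horizontal offsets, so the quotient rule used for `slope`
  -- applies with their roles exchanged.
  have e (y : Fin 4 → ℝ) : √(y 2 ^ 2 + (y 1 - c * y 0) ^ 2 + h ^ 2) = radius c h y := by
    rw [radius, add_comm (y 2 ^ 2)]
  simp only [e] at key
  rw [mul_comm (slope c h q)]
  exact key

lemma contDiff_radius (hh : 0 < h) (c : ℝ) : ContDiff ℝ ∞ (radius c h) := by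
  refine ContDiff.sqrt (by fun_prop) fun q => ?_
  positivity

lemma contDiff_slope (hh : 0 < h) (c : ℝ) : ContDiff ℝ ∞ (slope c h) :=
  ContDiff.div (by fun_prop) (contDiff_radius hh c) fun q => (radius_pos hh c q).ne'

lemma contDiff_tilt (hh : 0 < h) (c : ℝ) : ContDiff ℝ ∞ (tilt c h) :=
  ContDiff.div (by fun_prop) (contDiff_radius hh c) fun q => (radius_pos hh c q).ne'

/-- Transmitter and receiver are the instances `c = α` and `c = 1` of one family, so every
derivative formula is needed only once. -/
lemma param_eq (α h : ℝ) (q : Fin 4 → ℝ) : param α h q =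
    ((![q 0, radius α h q + radius 1 h q],
      ![-q 3 * (α * slope α h q + slope 1 h q), -q 3]),
     (![q 1, q 2],
      ![-q 3 * (slope α h q + slope 1 h q), -q 3 * (tilt α h q + tilt 1 h q)])) := by
  simp [param, relationPoint, distT, distR, slope, tilt, radius]

lemma contDiff_param (hh : 0 < h) (α : ℝ) : ContDiff ℝ ∞ (param α h) := by
  have h1 := contDiff_radius hh α
  have h2 := contDiff_radius hh 1
  have h3 := contDiff_slope hh α
  have h4 := contDiff_slope hh 1
  have h5 := contDiff_tilt hh α
  have h6 := contDiff_tilt hh 1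
  rw [funext (param_eq α h)]
  refine ContDiff.prodMk (ContDiff.prodMk ?_ ?_) (ContDiff.prodMk ?_ ?_) <;>
    refine contDiff_pi.2 fun i => ?_ <;> fin_cases i <;> simp <;> fun_prop

/-- Differential of the parametrization. -/
lemma fderiv_param_apply (hh : 0 < h) (α : ℝ) (q v : Fin 4 → ℝ) :
    fderiv ℝ (param α h) q v =
    ((![v 0, fderiv ℝ (radius α h) q v + fderiv ℝ (radius 1 h) q v],
      ![-v 3 * (α * slope α h q + slope 1 h q)
        - q 3 * (α * fderiv ℝ (slope α h) q v + fderiv ℝ (slope 1 h) q v), -v 3]),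
     (![v 1, v 2],
      ![-v 3 * (slope α h q + slope 1 h q)
        - q 3 * (fderiv ℝ (slope α h) q v + fderiv ℝ (slope 1 h) q v),
        -v 3 * (tilt α h q + tilt 1 h q)
        - q 3 * (fderiv ℝ (tilt α h) q v + fderiv ℝ (tilt 1 h) q v)])) := by
  have hd (i : Fin 4) : HasFDerivAt (fun q : Fin 4 → ℝ => q i)
    (ContinuousLinearMap.proj i : (Fin 4 → ℝ) →L[ℝ] ℝ) q := hasFDerivAt_apply i q
  have hr (c : ℝ) := (hasFDerivAt_radius hh c q).differentiableAt.hasFDerivAt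
  have hs (c : ℝ) := (hasFDerivAt_slope hh c q).differentiableAt.hasFDerivAt
  have ht (c : ℝ) := (hasFDerivAt_tilt hh c q).differentiableAt.hasFDerivAt
  have hp := ((contDiff_param hh α).differentiable (by simp) q).hasFDerivAt
  have c1 := hp.fst.fst
  have c2 := hp.fst.snd
  have c3 := hp.snd.fst
  have c4 := hp.snd.snd
  simp only [param_eq] at c1 c2 c3 c4
  ext i <;> fin_cases i
  · exact congrArg (· v) (((hasFDerivAt_pi'.1 c1) 0).unique (hd 0))
  · exact congrArg (· v) (((hasFDerivAt_pi'.1 c1) 1).unique ((hr α).add (hr 1)))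
  · have := congrArg (· v) (((hasFDerivAt_pi'.1 c2) 0).unique
      ((hd 3).neg.mul (((hs α).const_mul α).add (hs 1))))
    simp at this ⊢
    linarith
  · exact congrArg (· v) (((hasFDerivAt_pi'.1 c2) 1).unique (hd 3).neg)
  · exact congrArg (· v) (((hasFDerivAt_pi'.1 c3) 0).unique (hd 1))
  · exact congrArg (· v) (((hasFDerivAt_pi'.1 c3) 1).unique (hd 2))
  · have := congrArg (· v) (((hasFDerivAt_pi'.1 c4) 0).unique ((hd 3).neg.mul ((hs α).add (hs 1))))
    simp at this ⊢
    linarith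
  · have := congrArg (· v) (((hasFDerivAt_pi'.1 c4) 1).unique ((hd 3).neg.mul ((ht α).add (ht 1))))
    simp at this ⊢
    linarith

lemma fderiv_projL_apply (hh : 0 < h) (α : ℝ) (q v : Fin 4 → ℝ) :
    fderiv ℝ (projL α h) q v = (fderiv ℝ (param α h) q v).1 := by
  rw [show projL α h = fun q => (param α h q).1 from rfl,
    fderiv.fst ((contDiff_param hh α).differentiable (by simp) q)]
  rfl

lemma fderiv_projR_apply (hh : 0 < h) (α : ℝ) (q v : Fin 4 → ℝ) :
    fderiv ℝ (projR α h) q v = (fderiv ℝ (param α h) q v).2 := by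
  rw [show projR α h = fun q => (param α h q).2 from rfl,
    fderiv.snd ((contDiff_param hh α).differentiable (by simp) q)]
  rfl

end SAR

/-! ### Local diffeomorphisms and simple rank drops -/

section Jacobian

variable {E F : Type*} [NormedAddCommGroup E] [NormedSpace ℝ E]
  [NormedAddCommGroup F] [NormedSpace ℝ F] {L : F ≃L[ℝ] E} {f : E → F} {q : E}

lemma continuous_jacobianDet (L : F ≃L[ℝ] E) (hf : ContDiff ℝ ∞ f) :
    Continuous (jacobianDet L f) := by
  have h := hf.continuous_fderiv (by simp)
  exact ContinuousLinearMap.continuous_det.comp (continuous_const.clm_comp h)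

variable [FiniteDimensional ℝ E]

lemma hasFDerivAt_equiv_of_jacobianDet_ne_zero (hf : ContDiff ℝ ∞ f)
    (hq : jacobianDet L f q ≠ 0) : ∃ e : E ≃L[ℝ] F, HasFDerivAt f (e : E →L[ℝ] F) q := by
  refine ⟨(ContinuousLinearMap.toContinuousLinearEquivOfDetNeZero _ hq).trans L.symm, ?_⟩
  refine (hf.differentiable (by simp) q).hasFDerivAt.congr_fderiv ?_
  ext v
  exact (L.symm_apply_apply _).symm

lemma isLocalDiffeomorphAt_of_jacobianDet_ne_zero (hf : ContDiff ℝ ∞ f)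
    (hq : jacobianDet L f q ≠ 0) : IsLocalDiffeomorphAt 𝓘(ℝ, E) 𝓘(ℝ, F) ∞ f q := by
  have : CompleteSpace E := FiniteDimensional.complete ℝ E
  obtain ⟨e, he⟩ := hasFDerivAt_equiv_of_jacobianDet_ne_zero hf hq
  have hU : IsOpen {p | jacobianDet L f p ≠ 0} :=
    isOpen_ne_fun (continuous_jacobianDet L hf) continuous_const
  -- The inverse must be smooth on the whole target, not only at `f q`. Shrinking the source to the
  -- points of nonzero Jacobian makes the differential invertible at every preimage.
  let Φ := (hf.contDiffAt.toOpenPartialHomeomorph f he (by simp)).restrOpen _ hU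
  have hΦ : (Φ : E → F) = f := rfl
  refine ⟨⟨Φ.toPartialEquiv, Φ.open_source, Φ.open_target, ?_, ?_⟩, ?_, fun x _ => rfl⟩
  · exact contMDiffOn_iff_contDiffOn.2 hf.contDiffOn
  · refine contMDiffOn_iff_contDiffOn.2 fun y hy => ?_
    obtain ⟨e', he'⟩ := hasFDerivAt_equiv_of_jacobianDet_ne_zero (L := L) hf
      (show jacobianDet L f (Φ.symm y) ≠ 0 from (Φ.map_target hy).2)
    exact (Φ.contDiffAt_symm hy he' hf.contDiffAt).contDiffWithinAt
  · exact ⟨hf.contDiffAt.mem_toOpenPartialHomeomorph_source he (by simp), hq⟩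

/-- If the Jacobian determinant is `u · w` with `u` linear and `w` nonvanishing, and the kernel of
the differential is a line where `u = 0`, then the rank drops simply along `u = 0`. -/
lemma dropsRankByOneSimply_of_jacobianDet_eq (L : F ≃L[ℝ] E) {D : Set E} (u : E →L[ℝ] ℝ)
    (hu : u ≠ 0) {w : E → ℝ} (hw : Differentiable ℝ w) (hw0 : ∀ q ∈ D, w q ≠ 0)
    (hdet : ∀ q, jacobianDet L f q = u q * w q)
    (hker : ∀ q ∈ D, u q = 0 → ∃ e : E, e ≠ 0 ∧ ∀ v, fderiv ℝ f q v = 0 ↔ ∃ r : ℝ, r • e = v) :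
    DropsRankByOneSimply f D {q ∈ D | u q = 0} := by
  refine ⟨L, ?_, fun q hq => ⟨?_, ?_⟩⟩
  · ext q
    refine and_congr_right fun hq => ?_
    rw [hdet, mul_eq_zero, or_iff_left (hw0 q hq)]
  · obtain ⟨e, he, hv⟩ := hker q hq.1 hq.2
    have hspan : LinearMap.ker (fderiv ℝ f q).toLinearMap = Submodule.span ℝ {e} := by
      ext v
      rw [Submodule.mem_span_singleton, ← hv]
      rfl
    rw [← LinearMap.finrank_range_add_finrank_ker (fderiv ℝ f q).toLinearMap, hspan,
      finrank_span_singleton he]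
  · have hd : HasFDerivAt (jacobianDet L f) (w q • u) q := by
      rw [funext hdet]
      refine (u.hasFDerivAt.mul (hw q).hasFDerivAt).congr_fderiv ?_
      rw [hq.2]
      simp
    rw [hd.fderiv]
    exact smul_ne_zero (hw0 q hq.1) hu

end Jacobian

/-! ### Jacobian determinants of the two projections. -/

namespace SAR

variable {α c h : ℝ} {q : Fin 4 → ℝ}

/-- The coordinates `(y, η) ↦ (y₁, y₂, η₁, η₂)` of `T*ℝ²`. -/
def cotangentEquiv : Cotangent 2 ≃L[ℝ] (Fin 4 → ℝ) :=
  LinearEquiv.toContinuousLinearEquiv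
    { toFun := fun c => ![c.1 0, c.1 1, c.2 0, c.2 1]
      invFun := fun v => (![v 0, v 1], ![v 2, v 3])
      map_add' := fun a b => by ext i; fin_cases i <;> rfl
      map_smul' := fun a b => by ext i; fin_cases i <;> rfl
      left_inv := fun c => by ext i <;> fin_cases i <;> rfl
      right_inv := fun v => by ext i; fin_cases i <;> rfl }

lemma cotangentEquiv_apply (c : Cotangent 2) :
    cotangentEquiv c = ![c.1 0, c.1 1, c.2 0, c.2 1] := rfl

/-- Up to the factor `x₂ ω`, the Jacobian determinant of both projections. -/
def weight (α h : ℝ) (q : Fin 4 → ℝ) : ℝ :=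
  (α / radius α h q ^ 2 + 1 / radius 1 h q ^ 2) * (1 + slope α h q * slope 1 h q)
    + (α * (1 - slope α h q ^ 2) + (1 - slope 1 h q ^ 2)) / (radius α h q * radius 1 h q)

/-- Both slopes have square less than 1, and `(a + b)² ≥ 0` then forces `1 + ab > 0`. With `α ≥ 0`
no summand is negative, and the receiver's terms are positive. -/
lemma weight_pos (hα : 0 ≤ α) (hh : 0 < h) (q : Fin 4 → ℝ) : 0 < weight α h q := by
  have h1 := slope_sq_lt_one hh α q
  have h2 := slope_sq_lt_one hh 1 q
  have h3 : 0 < 1 + slope α h q * slope 1 h q := by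
    nlinarith [sq_nonneg (slope α h q + slope 1 h q)]
  have r1 := radius_pos hh α q
  have r2 := radius_pos hh 1 q
  have h4 : 0 < α * (1 - slope α h q ^ 2) + (1 - slope 1 h q ^ 2) :=
    add_pos_of_nonneg_of_pos (mul_nonneg hα (by linarith)) (by linarith)
  unfold weight
  positivity

lemma contDiff_weight (hh : 0 < h) (α : ℝ) : ContDiff ℝ ∞ (weight α h) := by
  have h1 := contDiff_radius hh α
  have h2 := contDiff_radius hh 1
  have h3 := contDiff_slope hh α
  have h4 := contDiff_slope hh 1
  have r1 (q : Fin 4 → ℝ) := (radius_pos hh α q).ne'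
  have r2 (q : Fin 4 → ℝ) := (radius_pos hh 1 q).ne'
  unfold weight
  refine ContDiff.add (ContDiff.mul (ContDiff.add ?_ ?_) (by fun_prop)) ?_
  · exact contDiff_const.div (h1.pow 2) fun q => pow_ne_zero 2 (r1 q)
  · exact contDiff_const.div (h2.pow 2) fun q => pow_ne_zero 2 (r2 q)
  · exact ContDiff.div (by fun_prop) (h1.mul h2) fun q => mul_ne_zero (r1 q) (r2 q)

lemma jacobianDet_eq_det (f : (Fin 4 → ℝ) → Cotangent 2) (q : Fin 4 → ℝ) :
    jacobianDet cotangentEquiv f q =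
      (Matrix.of fun i j => cotangentEquiv (fderiv ℝ f q (Pi.single j 1)) i).det := by
  unfold jacobianDet ContinuousLinearMap.det
  rw [← LinearMap.det_toMatrix']
  rfl

lemma fderiv_radius_apply (hh : 0 < h) (c : ℝ) (q v : Fin 4 → ℝ) :
    fderiv ℝ (radius c h) q v = slope c h q * (v 1 - c * v 0) + tilt c h q * v 2 := by
  simp [(hasFDerivAt_radius hh c q).fderiv]

lemma fderiv_slope_apply (hh : 0 < h) (c : ℝ) (q v : Fin 4 → ℝ) :
    fderiv ℝ (slope c h) q v = (1 - slope c h q ^ 2) / radius c h q * (v 1 - c * v 0)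
      - slope c h q * tilt c h q / radius c h q * v 2 := by
  simp [(hasFDerivAt_slope hh c q).fderiv]

lemma fderiv_tilt_apply (hh : 0 < h) (c : ℝ) (q v : Fin 4 → ℝ) :
    fderiv ℝ (tilt c h) q v = (1 - tilt c h q ^ 2) / radius c h q * v 2
      - slope c h q * tilt c h q / radius c h q * (v 1 - c * v 0) := by
  simp [(hasFDerivAt_tilt hh c q).fderiv]

lemma jacobianDet_projL (hh : 0 < h) (α : ℝ) (q : Fin 4 → ℝ) :
    jacobianDet cotangentEquiv (projL α h) q = q 2 * (-q 3 * weight α h q) := by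
  have r1 := (radius_pos hh α q).ne'
  have r2 := (radius_pos hh 1 q).ne'
  have hM : (Matrix.of fun i j =>
      cotangentEquiv (fderiv ℝ (projL α h) q (Pi.single j 1)) i : Matrix (Fin 4) (Fin 4) ℝ) =
      Matrix.of ![Pi.single 0 1, fun j => fderiv ℝ (radius α h) q (Pi.single j 1)
          + fderiv ℝ (radius 1 h) q (Pi.single j 1),
        fun j => -(Pi.single j 1 : Fin 4 → ℝ) 3 * (α * slope α h q + slope 1 h q)
          - q 3 * (α * fderiv ℝ (slope α h) q (Pi.single j 1)
            + fderiv ℝ (slope 1 h) q (Pi.single j 1)), -Pi.single 3 1] := by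
    ext i j
    fin_cases i <;> simp [fderiv_projL_apply hh, fderiv_param_apply hh, cotangentEquiv_apply,
      Pi.single_apply, eq_comm]
  -- The rows of `s` and `τ` are coordinate vectors up to sign, so only the minor of `(t, σ)` in
  -- `(x₁, x₂)` survives.
  rw [jacobianDet_eq_det, hM, Matrix.det_succ_row_zero]
  simp only [fderiv_radius_apply hh, fderiv_slope_apply hh]
  simp [Matrix.det_fin_three, Pi.single_apply]
  have e1 : tilt α h q = q 2 / radius α h q := rfl
  have e2 : tilt 1 h q = q 2 / radius 1 h q := rfl
  rw [e1, e2, weight]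
  field_simp
  ring

/-- The agreement with `jacobianDet_projL` is no accident: on a canonical relation the two
symplectic forms have equal pullbacks, hence so do their top exterior powers. -/
lemma jacobianDet_projR (hh : 0 < h) (α : ℝ) (q : Fin 4 → ℝ) :
    jacobianDet cotangentEquiv (projR α h) q = q 2 * (-q 3 * weight α h q) := by
  have r1 := (radius_pos hh α q).ne'
  have r2 := (radius_pos hh 1 q).ne'
  have hM : (Matrix.of fun i j =>
      cotangentEquiv (fderiv ℝ (projR α h) q (Pi.single j 1)) i : Matrix (Fin 4) (Fin 4) ℝ) =
      Matrix.of ![Pi.single 1 1, Pi.single 2 1,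
        fun j => -(Pi.single j 1 : Fin 4 → ℝ) 3 * (slope α h q + slope 1 h q)
          - q 3 * (fderiv ℝ (slope α h) q (Pi.single j 1)
            + fderiv ℝ (slope 1 h) q (Pi.single j 1)),
        fun j => -(Pi.single j 1 : Fin 4 → ℝ) 3 * (tilt α h q + tilt 1 h q)
          - q 3 * (fderiv ℝ (tilt α h) q (Pi.single j 1)
            + fderiv ℝ (tilt 1 h) q (Pi.single j 1))] := by
    ext i j
    fin_cases i <;> simp [fderiv_projR_apply hh, fderiv_param_apply hh, cotangentEquiv_apply,
      Pi.single_apply, eq_comm]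
  -- The rows of `x₁` and `x₂` are coordinate vectors; what remains is the minor of `(ξ₁, ξ₂)` in
  -- `(s, ω)`.
  rw [jacobianDet_eq_det, hM, Matrix.det_succ_row_zero]
  simp only [fderiv_tilt_apply hh, fderiv_slope_apply hh]
  have hs : Fin.succAbove (1 : Fin 4) (2 : Fin 3) = 3 := rfl
  simp [hs, Matrix.det_fin_three, Pi.single_apply]
  have e1 : tilt α h q = q 2 / radius α h q := rfl
  have e2 : tilt 1 h q = q 2 / radius 1 h q := rfl
  rw [e1, e2, weight]
  field_simp
  ring

end SAR

namespace SAR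

variable {α c h : ℝ} {q : Fin 4 → ℝ}

/-! ### Fold and blowdown -/

lemma isOpen_paramDomain (α : ℝ) : IsOpen (paramDomain α) := by
  refine (isOpen_lt continuous_const (continuous_apply 0)).inter
    ((isOpen_ne_fun (continuous_apply 3) continuous_const).inter ?_)
  exact ((isClosed_eq (by fun_prop) (by fun_prop)).inter
    (isClosed_eq (by fun_prop) continuous_const)).isOpen_compl

lemma contDiff_projL (hh : 0 < h) (α : ℝ) : ContDiff ℝ ∞ (projL α h) := (contDiff_param hh α).fst

lemma contDiff_projR (hh : 0 < h) (α : ℝ) : ContDiff ℝ ∞ (projR α h) := (contDiff_param hh α).snd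

/-- Up to the factor `-ω`, the derivative of the slope sum along the transmitter motion. -/
lemma slope_rate_pos (hα : 0 ≤ α) (hh : 0 < h) (q : Fin 4 → ℝ) :
    0 < α * ((1 - slope α h q ^ 2) / radius α h q) + (1 - slope 1 h q ^ 2) / radius 1 h q := by
  have h1 := slope_sq_lt_one hh α q
  have h2 := slope_sq_lt_one hh 1 q
  exact add_pos_of_nonneg_of_pos
    (mul_nonneg hα (div_nonneg (by linarith) (radius_pos hh α q).le))
    (div_pos (by linarith) (radius_pos hh 1 q))

/-- On `x₂ = 0` the tilts vanish, so `v 2` enters no component. The `s` and `τ` components kill `v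
0` and `v 3`, and the `σ` component then kills `v 1` because its coefficient is `ω` times the
positive quantity of `slope_rate_pos`. -/
lemma fderiv_projL_eq_zero_iff (hα : 0 ≤ α) (hh : 0 < h) (h3 : q 3 ≠ 0) (h2 : q 2 = 0)
    (v : Fin 4 → ℝ) :
    fderiv ℝ (projL α h) q v = 0 ↔ v 0 = 0 ∧ v 1 = 0 ∧ v 3 = 0 := by
  have t0 (c : ℝ) : tilt c h q = 0 := by simp [tilt, h2]
  rw [fderiv_projL_apply hh, fderiv_param_apply hh]
  simp only [fderiv_radius_apply hh, fderiv_slope_apply hh, t0]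
  have hM := (slope_rate_pos hα hh q).ne'
  constructor
  · intro H
    have e0 := congrFun (congrArg Prod.fst H) 0
    have e2 := congrFun (congrArg Prod.snd H) 0
    have e3 := congrFun (congrArg Prod.snd H) 1
    simp at e0 e2 e3
    rw [e0, e3] at e2
    refine ⟨e0, ?_, e3⟩
    have : q 3 * ((α * ((1 - slope α h q ^ 2) / radius α h q)
      + (1 - slope 1 h q ^ 2) / radius 1 h q) * v 1) = 0 := by linear_combination -e2
    simpa [h3, hM] using this
  · rintro ⟨e0, e1, e3⟩
    ext i <;> fin_cases i <;> simp [e0, e1, e3]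

/-- With the tilts zero, the `ξ₂` component is automatic once `v 2 = 0`, leaving one linear equation
between `v 0` and `v 3`. The kernel therefore never leaves `x₂ = 0`. -/
lemma fderiv_projR_eq_zero_iff (hh : 0 < h) (h2 : q 2 = 0) (v : Fin 4 → ℝ) :
    fderiv ℝ (projR α h) q v = 0 ↔ v 1 = 0 ∧ v 2 = 0 ∧
      q 3 * (α * ((1 - slope α h q ^ 2) / radius α h q)
        + (1 - slope 1 h q ^ 2) / radius 1 h q) * v 0 = (slope α h q + slope 1 h q) * v 3 := by
  have t0 (c : ℝ) : tilt c h q = 0 := by simp [tilt, h2]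
  rw [fderiv_projR_apply hh, fderiv_param_apply hh]
  simp only [fderiv_tilt_apply hh, fderiv_slope_apply hh, t0]
  constructor
  · intro H
    have e0 := congrFun (congrArg Prod.fst H) 0
    have e1 := congrFun (congrArg Prod.fst H) 1
    have e2 := congrFun (congrArg Prod.snd H) 0
    simp at e0 e1 e2
    rw [e0] at e2
    exact ⟨e0, e1, by linear_combination e2⟩
  · rintro ⟨e0, e1, e2⟩
    ext i <;> fin_cases i <;> simp [e0, e1]
    linear_combination e2

lemma differentiable_jacobian_factor (hh : 0 < h) (α : ℝ) :
    Differentiable ℝ fun q : Fin 4 → ℝ => -q 3 * weight α h q := by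
  have := (contDiff_weight hh α).differentiable (by simp)
  fun_prop

lemma proj_two_ne_zero : (ContinuousLinearMap.proj 2 : (Fin 4 → ℝ) →L[ℝ] ℝ) ≠ 0 := fun H => by
  simpa using DFunLike.congr_fun H (Pi.single 2 1)

lemma dropsRankByOneSimply_projL (hα : 0 ≤ α) (hh : 0 < h) :
    DropsRankByOneSimply (projL α h) (paramDomain α) (sigmaOne α) := by
  refine dropsRankByOneSimply_of_jacobianDet_eq cotangentEquiv _ proj_two_ne_zero
    (differentiable_jacobian_factor hh α)
    (fun q hq => mul_ne_zero (neg_ne_zero.2 hq.2.1) (weight_pos hα hh q).ne')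
    (jacobianDet_projL hh α) fun q hq h2 => ⟨Pi.single 2 1, by simp, fun v => ?_⟩
  rw [fderiv_projL_eq_zero_iff hα hh hq.2.1 h2]
  constructor
  · rintro ⟨e0, e1, e3⟩
    refine ⟨v 2, ?_⟩
    ext i
    fin_cases i <;> simp [e0, e1, e3]
  · rintro ⟨r, rfl⟩
    simp

lemma dropsRankByOneSimply_projR (hα : 0 ≤ α) (hh : 0 < h) :
    DropsRankByOneSimply (projR α h) (paramDomain α) (sigmaOne α) := by
  refine dropsRankByOneSimply_of_jacobianDet_eq cotangentEquiv _ proj_two_ne_zero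
    (differentiable_jacobian_factor hh α)
    (fun q hq => mul_ne_zero (neg_ne_zero.2 hq.2.1) (weight_pos hα hh q).ne')
    (jacobianDet_projR hh α) fun q hq h2 => ⟨![(slope α h q + slope 1 h q) / (q 3 *
      (α * ((1 - slope α h q ^ 2) / radius α h q) + (1 - slope 1 h q ^ 2) / radius 1 h q)),
      0, 0, 1], fun H => by simpa using congrFun H 3, fun v => ?_⟩
  have hM := mul_ne_zero hq.2.1 (slope_rate_pos hα hh q).ne'
  rw [fderiv_projR_eq_zero_iff hh h2]
  constructor
  · rintro ⟨e1, e2, e3⟩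
    refine ⟨v 3, ?_⟩
    ext i
    fin_cases i
    · simp only [Pi.smul_apply, smul_eq_mul, Fin.zero_eta, Matrix.cons_val_zero]
      rw [mul_div_assoc', div_eq_iff hM]
      linear_combination -e3
    · simp [e1]
    · simp [e2]
    · simp
  · rintro ⟨r, rfl⟩
    refine ⟨by simp, by simp, ?_⟩
    simp only [Pi.smul_apply, smul_eq_mul, Matrix.cons_val_zero]
    rw [mul_left_comm, mul_div_cancel₀ _ hM]
    simp [mul_comm]

lemma apply_two_eq_zero_of_mem_tangentVectors {q v : Fin 4 → ℝ}
    (hv : v ∈ tangentVectors (sigmaOne α) q) : v 2 = 0 := by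
  obtain ⟨γ, -, hd, hs⟩ := hv
  have h1 : HasDerivAt (fun r => γ r 2) (v 2) 0 := (hasDerivAt_pi.1 hd) 2
  exact h1.unique ((hasDerivAt_const 0 (0 : ℝ)).congr_of_eventuallyEq (hs.mono fun r hr => hr.2))

/-- `Σ₁` is relatively open in a hyperplane, so a straight segment serves as the curve. -/
lemma mem_tangentVectors_sigmaOne {q v : Fin 4 → ℝ} (hq : q ∈ sigmaOne α) (hv : v 2 = 0) :
    v ∈ tangentVectors (sigmaOne α) q := by
  have hd : HasDerivAt (fun r : ℝ => q + r • v) v 0 := by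
    simpa using ((hasDerivAt_id (0 : ℝ)).smul_const v).const_add q
  refine ⟨fun r => q + r • v, by simp, hd, ?_⟩
  have := hd.continuousAt.eventually_mem ((isOpen_paramDomain α).mem_nhds (by simpa using hq.1))
  filter_upwards [this] with r hr
  exact ⟨hr, by simp [hq.2, hv]⟩

lemma jacobian_factor_ne_zero (hα : 0 ≤ α) (hh : 0 < h) (hq : q ∈ paramDomain α \ sigmaOne α) :
    q 2 * (-q 3 * weight α h q) ≠ 0 :=
  mul_ne_zero (fun h2 => hq.2 ⟨hq.1, h2⟩)
    (mul_ne_zero (neg_ne_zero.2 hq.1.2.1) (weight_pos hα hh q).ne')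

lemma hasWhitneyFold_projL (hα : 0 ≤ α) (hh : 0 < h) :
    HasWhitneyFold (projL α h) (paramDomain α) (sigmaOne α) where
  isOpen := isOpen_paramDomain α
  smooth := (contDiff_projL hh α).contDiffOn
  localDiffeo q hq := isLocalDiffeomorphAt_of_jacobianDet_ne_zero (L := cotangentEquiv)
    (contDiff_projL hh α) (by
      rw [jacobianDet_projL hh]
      exact jacobian_factor_ne_zero hα hh hq)
  dropsRank := dropsRankByOneSimply_projL hα hh
  ker_not_subset q hq H := by
    have : (Pi.single 2 1 : Fin 4 → ℝ) ∈ {v | fderiv ℝ (projL α h) q v = 0} :=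
      (fderiv_projL_eq_zero_iff hα hh hq.1.2.1 hq.2 _).2 (by simp)
    simpa using apply_two_eq_zero_of_mem_tangentVectors (H this)

lemma hasBlowdown_projR (hα : 0 ≤ α) (hh : 0 < h) :
    HasBlowdown (projR α h) (paramDomain α) (sigmaOne α) where
  isOpen := isOpen_paramDomain α
  smooth := (contDiff_projR hh α).contDiffOn
  localDiffeo q hq := isLocalDiffeomorphAt_of_jacobianDet_ne_zero (L := cotangentEquiv)
    (contDiff_projR hh α) (by
      rw [jacobianDet_projR hh]
      exact jacobian_factor_ne_zero hα hh hq)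
  dropsRank := dropsRankByOneSimply_projR hα hh
  ker_subset q hq v hv :=
    mem_tangentVectors_sigmaOne hq ((fderiv_projR_eq_zero_iff hh hq.2 v).1 hv).2.1

/-! ### The canonical relation -/

/-- Reads off `(s, x₁, x₂, ω)` from a point of the canonical relation. -/
def relationCoords : Cotangent 2 × Cotangent 2 →L[ℝ] (Fin 4 → ℝ) :=
  LinearMap.toContinuousLinearMap
    { toFun := fun c => ![c.1.1 0, c.2.1 0, c.2.1 1, -c.1.2 1]
      map_add' := fun a b => by ext i; fin_cases i <;> simp [add_comm]
      map_smul' := fun a b => by ext i; fin_cases i <;> simp }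

lemma relationCoords_apply (c : Cotangent 2 × Cotangent 2) :
    relationCoords c = ![c.1.1 0, c.2.1 0, c.2.1 1, -c.1.2 1] := rfl

/-- A continuous linear left inverse yields at once that the parametrization is an immersion and an
embedding, and, in `closure_relation`, that its full image is closed. -/
lemma relationCoords_param (α h : ℝ) (q : Fin 4 → ℝ) : relationCoords (param α h q) = q := by
  ext i
  fin_cases i <;> simp [relationCoords_apply, param_eq]

lemma image_param (α h : ℝ) : param α h '' paramDomain α = relation α h := by
  ext c
  constructor
  · rintro ⟨q, hq, rfl⟩
    exact ⟨q 0, ![q 1, q 2], q 3, hq.1, hq.2.1, hq.2.2, rfl⟩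
  · rintro ⟨s, x, w, hs, hw, hx, rfl⟩
    refine ⟨![s, x 0, x 1, w], ⟨hs, hw, hx⟩, ?_⟩
    have : x = ![x 0, x 1] := by ext i; fin_cases i <;> rfl
    conv_rhs => rw [this]
    rfl

lemma isSmoothParametrization_param (hh : 0 < h) (α : ℝ) :
    IsSmoothParametrization (param α h) (paramDomain α) (relation α h) where
  isOpen := isOpen_paramDomain α
  smooth := (contDiff_param hh α).contDiffOn
  immersion q _ := by
    have h1 : HasFDerivAt (fun q => relationCoords (param α h q))
        (relationCoords.comp (fderiv ℝ (param α h) q)) q :=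
      relationCoords.hasFDerivAt.comp q
        ((contDiff_param hh α).differentiable (by simp) q).hasFDerivAt
    have h2 : relationCoords.comp (fderiv ℝ (param α h) q) = ContinuousLinearMap.id ℝ _ := by
      refine h1.unique ?_
      simp only [relationCoords_param]
      exact hasFDerivAt_id q
    exact Function.LeftInverse.injective (g := relationCoords)
      fun v => DFunLike.congr_fun h2 v
  isEmbedding := by
    have h0 : Topology.IsEmbedding (param α h) :=
      Function.LeftInverse.isEmbedding (relationCoords_param α h) relationCoords.continuous
        (contDiff_param hh α).continuous
    exact h0.comp Topology.IsEmbedding.subtypeVal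
  image_eq := image_param α h

end SAR

/-! ### The excluded midpoint: vanishing of `ξ` and minimal bistatic range. -/

namespace SAR

variable {α c h : ℝ} {q : Fin 4 → ℝ}

lemma slope_add_slope_eq_zero (hh : 0 < h) (α : ℝ) (q : Fin 4 → ℝ)
    (H : slope α h q + slope 1 h q = 0) : q 1 = (α + 1) * q 0 / 2 := by
  have r1 := radius_pos hh α q
  have r2 := radius_pos hh 1 q
  have e1 := sq_radius α h q
  have e2 := sq_radius 1 h q
  have H1 : (q 1 - α * q 0) * radius 1 h q = -((q 1 - 1 * q 0) * radius α h q) := by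
    unfold slope at H
    field_simp at H
    linarith
  set a := q 1 - α * q 0
  set b := q 1 - 1 * q 0
  -- Squaring `a B = -b A` and inserting the radii cancels `a² b²` and leaves `(a² - b²)(x₂² + h²) =
  -- 0`. Then `A = B`, and the unsquared equation fixes the sign: `a = -b`.
  have hab : a ^ 2 = b ^ 2 := by
    have H2 : a ^ 2 * radius 1 h q ^ 2 = b ^ 2 * radius α h q ^ 2 := by
      rw [← mul_pow, H1]
      ring
    rw [e1, e2] at H2
    have h3 : 0 < q 2 ^ 2 + h ^ 2 := by positivity
    have : (a ^ 2 - b ^ 2) * (q 2 ^ 2 + h ^ 2) = 0 := by linear_combination H2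
    rcases mul_eq_zero.1 this with h4 | h4 <;> linarith
  have hr : radius α h q = radius 1 h q := by
    rw [← sq_eq_sq₀ r1.le r2.le, e1, e2, hab]
  rw [hr, ← neg_mul] at H1
  have : a = -b := mul_right_cancel₀ r2.ne' H1
  simp only [a, b] at this
  linarith

/-- The bistatic range exceeds its value at the midpoint, where transmitter and receiver see the
specular reflection, precisely away from the midpoint. -/
lemma sqrt_lt_radius_add_radius_iff (hh : 0 < h) (α : ℝ) (q : Fin 4 → ℝ) :
    √((α - 1) ^ 2 * q 0 ^ 2 + 4 * h ^ 2) < radius α h q + radius 1 h q ↔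
      ¬ (q 1 = (α + 1) * q 0 / 2 ∧ q 2 = 0) := by
  have r1 := radius_pos hh α q
  have r2 := radius_pos hh 1 q
  have e1 := sq_radius α h q
  have e2 := sq_radius 1 h q
  rw [Real.sqrt_lt' (by positivity), iff_not_comm]
  set A := radius α h q
  set B := radius 1 h q
  -- This is the triangle inequality for `U = (x₁ - αs, x₂, h)` and `U' = (s - x₁, -x₂, h)`, of
  -- lengths `A` and `B`: the threshold is `|U + U'|²`, and `d` below is `U · U'`. Next, `id2` is
  -- Lagrange's identity `|U|²|U'|² = (U · U')² + |U × U'|²`; as `h ≠ 0`, the cross product vanishes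
  -- only at the midpoint.
  have id1 : (A + B) ^ 2 - ((α - 1) ^ 2 * q 0 ^ 2 + 4 * h ^ 2) =
      2 * (A * B - (h ^ 2 - (q 1 - α * q 0) * (q 1 - 1 * q 0) - q 2 ^ 2)) := by
    linear_combination e1 + e2
  have id2 : (A * B) ^ 2 = (h ^ 2 - (q 1 - α * q 0) * (q 1 - 1 * q 0) - q 2 ^ 2) ^ 2
      + 4 * (q 2) ^ 2 * h ^ 2 + (2 * q 1 - (α + 1) * q 0) ^ 2 * h ^ 2
      + (q 2) ^ 2 * ((α - 1) * q 0) ^ 2 := by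
    rw [mul_pow, e1, e2]
    ring
  set d := h ^ 2 - (q 1 - α * q 0) * (q 1 - 1 * q 0) - q 2 ^ 2
  have hAB : 0 < A * B := mul_pos r1 r2
  have hlt : (α - 1) ^ 2 * q 0 ^ 2 + 4 * h ^ 2 < (A + B) ^ 2 ↔ d < A * B := by
    constructor <;> intro <;> linarith
  rw [hlt, not_lt]
  constructor
  · rintro ⟨h1, h2⟩
    have hd : (A * B) ^ 2 = d ^ 2 := by
      rw [id2, h1, h2]
      ring
    have hpos : 0 ≤ d := by
      simp only [d, h1, h2]
      nlinarith [sq_nonneg ((α - 1) * q 0), sq_nonneg h]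
    exact ((sq_eq_sq₀ hAB.le hpos).1 hd).le
  · intro hle
    have h1 : (A * B) ^ 2 ≤ d ^ 2 := pow_le_pow_left₀ hAB.le hle 2
    have s1 : 0 ≤ (q 2) ^ 2 * h ^ 2 := by positivity
    have s2 : 0 ≤ (2 * q 1 - (α + 1) * q 0) ^ 2 * h ^ 2 := by positivity
    have s3 : 0 ≤ (q 2) ^ 2 * ((α - 1) * q 0) ^ 2 := by positivity
    have hh2 : h ^ 2 ≠ 0 := by positivity
    have t1 : (q 2) ^ 2 * h ^ 2 = 0 := by linarith
    have t2 : (2 * q 1 - (α + 1) * q 0) ^ 2 * h ^ 2 = 0 := by linarith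
    have u1 : q 2 = 0 := by simpa [hh.ne'] using t1
    have u2 : 2 * q 1 - (α + 1) * q 0 = 0 := by simpa [hh.ne'] using t2
    exact ⟨by linarith, u1⟩

/-! ### The phase function -/

/-- The parameters `(s, x₁, x₂, ω)` of a point `(s, t, x, ω)`. -/
def phaseCoords : PhaseDomain 2 2 1 →L[ℝ] (Fin 4 → ℝ) :=
  LinearMap.toContinuousLinearMap
    { toFun := fun p => ![p.1.1 0, p.1.2 0, p.1.2 1, p.2 0]
      map_add' := fun a b => by ext i; fin_cases i <;> simp
      map_smul' := fun a b => by ext i; fin_cases i <;> simp }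

lemma phaseCoords_apply (p : PhaseDomain 2 2 1) :
    phaseCoords p = ![p.1.1 0, p.1.2 0, p.1.2 1, p.2 0] := rfl

/-- The bistatic range `A + B` as a function of `(s, t, x, ω)`. -/
def range (α h : ℝ) (p : PhaseDomain 2 2 1) : ℝ :=
  radius α h (phaseCoords p) + radius 1 h (phaseCoords p)

/-- The time coordinate `t`. -/
def timeCoord : PhaseDomain 2 2 1 →L[ℝ] ℝ :=
  (ContinuousLinearMap.proj 1).comp
    ((ContinuousLinearMap.fst ℝ _ _).comp (ContinuousLinearMap.fst ℝ _ _))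

/-- The frequency coordinate `ω`. -/
def freqCoord : PhaseDomain 2 2 1 →L[ℝ] ℝ :=
  (ContinuousLinearMap.proj 0).comp (ContinuousLinearMap.snd ℝ _ _)

@[simp] lemma timeCoord_apply (p : PhaseDomain 2 2 1) : timeCoord p = p.1.1 1 := rfl

@[simp] lemma freqCoord_apply (p : PhaseDomain 2 2 1) : freqCoord p = p.2 0 := rfl

lemma phase_eq (α h : ℝ) (p : PhaseDomain 2 2 1) :
    phase α h p = -(freqCoord p) * (timeCoord p - range α h p) := by
  simp [phase, range, phaseCoords_apply, distT, distR, radius, sub_sub]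

lemma contDiff_range (hh : 0 < h) (α : ℝ) : ContDiff ℝ ∞ (range α h) :=
  ((contDiff_radius hh α).comp phaseCoords.contDiff).add
    ((contDiff_radius hh 1).comp phaseCoords.contDiff)

lemma contDiff_phase (hh : 0 < h) (α : ℝ) : ContDiff ℝ ∞ (phase α h) := by
  rw [funext (phase_eq α h)]
  have := contDiff_range hh α
  fun_prop

lemma fderiv_range_apply (hh : 0 < h) (α : ℝ) (p w : PhaseDomain 2 2 1) :
    fderiv ℝ (range α h) p w =
      slope α h (phaseCoords p) * (w.1.2 0 - α * w.1.1 0)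
        + tilt α h (phaseCoords p) * w.1.2 1
      + (slope 1 h (phaseCoords p) * (w.1.2 0 - w.1.1 0)
        + tilt 1 h (phaseCoords p) * w.1.2 1) := by
  have hr (c : ℝ) := (hasFDerivAt_radius hh c (phaseCoords p)).comp p phaseCoords.hasFDerivAt
  have hd : HasFDerivAt (range α h) _ p := (hr α).add (hr 1)
  rw [hd.fderiv]
  simp [phaseCoords_apply]

lemma fderiv_phase_apply (hh : 0 < h) (α : ℝ) (p w : PhaseDomain 2 2 1) :
    fderiv ℝ (phase α h) p w = -(w.2 0) * (p.1.1 1 - range α h p)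
      - p.2 0 * (w.1.1 1 - fderiv ℝ (range α h) p w) := by
  have hr := ((contDiff_range hh α).differentiable (by simp) p).hasFDerivAt
  have hd : HasFDerivAt (fun p => -(freqCoord p) * (timeCoord p - range α h p)) _ p :=
    freqCoord.hasFDerivAt.neg.mul (timeCoord.hasFDerivAt.sub hr)
  rw [funext (phase_eq α h), hd.fderiv]
  simp
  ring

lemma gradTheta_phase (hh : 0 < h) (α : ℝ) (p : PhaseDomain 2 2 1) :
    gradTheta (phase α h) p = fun _ => -(p.1.1 1 - range α h p) := by
  ext i
  rw [Subsingleton.elim i 0, gradTheta, fderiv_phase_apply hh, fderiv_range_apply hh]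
  simp

lemma gradTheta_phase_eq_zero_iff (hh : 0 < h) (α : ℝ) (p : PhaseDomain 2 2 1) :
    gradTheta (phase α h) p = 0 ↔ p.1.1 1 = range α h p := by
  rw [gradTheta_phase hh, funext_iff, Unique.forall_iff, Pi.zero_apply, neg_eq_zero, sub_eq_zero]

lemma relationMap_phase (hh : 0 < h) (α : ℝ) {p : PhaseDomain 2 2 1}
    (hp : p.1.1 1 = range α h p) :
    relationMap (phase α h) p = param α h (phaseCoords p) := by
  rw [param_eq, relationMap]
  refine Prod.ext (Prod.ext ?_ ?_) (Prod.ext ?_ ?_)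
  · ext i; fin_cases i
    · rfl
    · exact hp
  · ext i
    fin_cases i <;>
    simp [gradY, fderiv_phase_apply hh, fderiv_range_apply hh, phaseCoords_apply]
    exact Or.inl (by ring)
  · ext i; fin_cases i <;> rfl
  · ext i
    fin_cases i <;>
    simp [gradX, fderiv_phase_apply hh, fderiv_range_apply hh, phaseCoords_apply] <;> ring

lemma mem_paramDomain_of_critical (hh : 0 < h) {p : PhaseDomain 2 2 1} (hp : p ∈ phaseCone α h)
    (hc : p.1.1 1 = range α h p) : phaseCoords p ∈ paramDomain α := by
  refine ⟨hp.1.1, fun H => hp.2 ?_, ?_⟩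
  · ext i
    rw [Subsingleton.elim i 0]
    exact H
  · rw [← sqrt_lt_radius_add_radius_iff hh]
    exact hp.1.2.trans_eq hc

/-- Criticality means `t = A + B`, and for such `t` the signal region excludes exactly the midpoint.
-/
theorem phaseRelation_phase (hh : 0 < h) (α : ℝ) :
    phaseRelation (phase α h) (phaseCone α h) = relation α h := by
  rw [← image_param]
  ext c
  constructor
  · rintro ⟨p, ⟨hp, hg⟩, rfl⟩
    rw [gradTheta_phase_eq_zero_iff hh] at hg
    exact ⟨phaseCoords p, mem_paramDomain_of_critical hh hp hg, (relationMap_phase hh α hg).symm⟩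
  · rintro ⟨q, hq, rfl⟩
    have hcoords : phaseCoords ((![q 0, radius α h q + radius 1 h q], ![q 1, q 2]), ![q 3]) = q := by
      ext i
      fin_cases i <;> rfl
    have hc : radius α h q + radius 1 h q =
        range α h ((![q 0, radius α h q + radius 1 h q], ![q 1, q 2]), ![q 3]) := by
      rw [range, hcoords]
    refine ⟨((![q 0, radius α h q + radius 1 h q], ![q 1, q 2]), ![q 3]), ⟨⟨⟨hq.1, ?_⟩, ?_⟩, ?_⟩, ?_⟩
    · exact (sqrt_lt_radius_add_radius_iff hh α q).2 hq.2.2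
    · exact fun H => hq.2.1 (congrFun H 0)
    · exact (gradTheta_phase_eq_zero_iff hh α _).2 hc
    · rw [relationMap_phase hh α hc, hcoords]

lemma injOn_relationMap_phase (hh : 0 < h) (α : ℝ) :
    InjOn (relationMap (phase α h)) (criticalSet (phase α h) (phaseCone α h)) := by
  intro p hp p' hp' H
  have e1 : p.1.1 = p'.1.1 := congrArg (fun c => c.1.1) H
  have e2 : p.1.2 = p'.1.2 := congrArg (fun c => c.2.1) H
  rw [relationMap_phase hh α ((gradTheta_phase_eq_zero_iff hh α p).1 hp.2),
    relationMap_phase hh α ((gradTheta_phase_eq_zero_iff hh α p').1 hp'.2)] at H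
  have e3 := congrFun (congrArg relationCoords H) 3
  rw [relationCoords_param, relationCoords_param] at e3
  refine Prod.ext (Prod.ext e1 e2) ?_
  ext i
  rw [Subsingleton.elim i 0]
  exact e3

lemma definesOpenPiece_phase (hh : 0 < h) (α : ℝ) :
    DefinesOpenPiece (phase α h) (phaseCone α h) (relation α h) :=
  ⟨injOn_relationMap_phase hh α, univ, isOpen_univ, by
    rw [phaseRelation_phase hh, inter_univ]⟩

lemma isOpen_signalRegion (α h : ℝ) : IsOpen (signalRegion α h) :=
  (isOpen_lt continuous_const (continuous_apply 0)).inter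
    (isOpen_lt (by fun_prop) (continuous_apply 1))

lemma signalRegion_subset (α h : ℝ) : signalRegion α h ⊆ dataSpace := fun _ hy =>
  ⟨hy.1, (Real.sqrt_nonneg _).trans_lt hy.2⟩

lemma isNondegeneratePhase_phase (hh : 0 < h) (α : ℝ) :
    IsNondegeneratePhase (phase α h) (phaseCone α h) where
  isOpen := ((isOpen_signalRegion α h).preimage (by fun_prop)).inter
    (isOpen_ne_fun continuous_snd continuous_const)
  theta_ne_zero p hp := hp.2
  conic p hp r hr := ⟨hp.1, smul_ne_zero hr.ne' hp.2⟩
  smooth := (contDiff_phase hh α).contDiffOn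
  homogeneous p _ r _ := by
    simp [phase]
    ring
  fderiv_ne_zero p hp H := by
    have := DFunLike.congr_fun H (((Pi.single 1 1, 0), 0) : PhaseDomain 2 2 1)
    rw [fderiv_phase_apply hh, fderiv_range_apply hh] at this
    simp at this
    refine hp.2 ?_
    ext i
    rw [Subsingleton.elim i 0]
    exact this
  linearIndependent p _ := by
    have hr := ((contDiff_range hh α).differentiable (by simp) p).hasFDerivAt
    refine linearIndependent_unique_iff.2 fun H => ?_
    simp only [gradTheta_phase hh] at H
    have hd := (timeCoord.hasFDerivAt.sub hr).neg
    rw [show (fun q : PhaseDomain 2 2 1 => -(q.1.1 1 - range α h q)) =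
      fun q => -(timeCoord q - range α h q) from rfl] at H
    erw [hd.fderiv] at H
    -- The mixed derivative `∂ₜ∂_ω φ` is the constant `-1`.
    have := DFunLike.congr_fun H (((Pi.single 1 1, 0), 0) : PhaseDomain 2 2 1)
    simp [fderiv_range_apply hh] at this

/-! ### The relation is canonical -/

lemma relation_subset (hh : 0 < h) (α : ℝ) :
    relation α h ⊆ puncturedCotangentProd dataSpace objectSpace := by
  rw [← image_param]
  rintro _ ⟨q, hq, rfl⟩
  rw [param_eq]
  refine ⟨⟨hq.1, add_pos (radius_pos hh α q) (radius_pos hh 1 q)⟩, fun H => ?_, trivial,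
    fun H => ?_⟩
  · simpa [hq.2.1] using congrFun H 1
  · have e0 := congrFun H 0
    have e1 := congrFun H 1
    simp [hq.2.1] at e0 e1
    refine hq.2.2 ⟨slope_add_slope_eq_zero hh α q e0, ?_⟩
    have r1 := radius_pos hh α q
    have r2 := radius_pos hh 1 q
    have : q 2 * (1 / radius α h q + 1 / radius 1 h q) = 0 := by
      rw [← e1, tilt, tilt]
      ring
    exact (mul_eq_zero.1 this).resolve_right (by positivity)

lemma closure_relation (hh : 0 < h) (α : ℝ) :
    closure (relation α h) ∩ puncturedCotangentProd dataSpace objectSpace ⊆ relation α h := by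
  rintro c ⟨hc, hs, hη, -, hξ⟩
  -- A limit point is still a value of `param`, so only membership of its coordinates in
  -- `paramDomain` is at stake: `ω = 0` would give `η = 0`, and the midpoint would give `ξ = 0`.
  have hcl : IsClosed {c | param α h (relationCoords c) = c} :=
    isClosed_eq ((contDiff_param hh α).continuous.comp relationCoords.continuous) continuous_id
  have hsub : relation α h ⊆ {c | param α h (relationCoords c) = c} := by
    rw [← image_param]
    rintro _ ⟨q, -, rfl⟩
    exact congrArg _ (relationCoords_param α h q)
  have hcp : param α h (relationCoords c) = c := closure_minimal hsub hcl hc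
  rw [← image_param]
  set q := relationCoords c
  rw [param_eq] at hcp
  have hη' := hη
  rw [← hcp] at hη hξ hs
  refine ⟨q, ⟨hs.1, fun H => hη ?_, fun H => hξ ?_⟩, by rw [param_eq, hcp]⟩
  · ext i
    fin_cases i <;> simp [H]
  · have hrad : radius α h q = radius 1 h q := by
      rw [radius, radius, H.1]
      ring_nf
    have e : slope α h q + slope 1 h q = 0 := by
      rw [slope, slope, hrad, ← add_div, H.1]
      ring_nf
    ext i
    fin_cases i <;> simp [e, tilt, H.2]

lemma isCanonicalRelation_relation (hh : 0 < h) (α : ℝ) :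
    IsCanonicalRelation dataSpace objectSpace (relation α h) where
  subset := relation_subset hh α
  closed := closure_relation hh α
  conic c hc r hr := by
    rw [← image_param] at hc ⊢
    obtain ⟨q, hq, rfl⟩ := hc
    refine ⟨![q 0, q 1, q 2, r * q 3], ⟨hq.1, mul_ne_zero hr.ne' hq.2.1, hq.2.2⟩, ?_⟩
    rw [param_eq, param_eq]
    refine Prod.ext (Prod.ext rfl ?_) (Prod.ext rfl ?_) <;> ext i <;> fin_cases i <;>
      simp [slope, tilt, radius, mul_assoc]
  lagrangian c hc := by
    refine ⟨param α h, paramDomain α, univ, isOpen_univ, mem_univ _, ?_, fun q _ v w => ?_⟩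
    · rw [inter_univ]
      exact isSmoothParametrization_param hh α
    -- The closing computation has a reason: since `t = A + B`, the one-form `σ ds + τ dt - ξ₁ dx₁ -
    -- ξ₂ dx₂` pulls back to zero, hence so does its exterior derivative.
    · erw [fderiv_param_apply hh α q v, fderiv_param_apply hh α q w]
      simp [symplecticForm, dotProduct, Fin.sum_univ_two, fderiv_radius_apply hh,
        fderiv_slope_apply hh, fderiv_tilt_apply hh]
      ring

end SAR

/-! ### The operator `1 - ∂ₑ` -/

section OneSubLineDeriv

variable {E E' : Type*} [NormedAddCommGroup E] [NormedSpace ℝ E] [NormedAddCommGroup E']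
  [NormedSpace ℝ E'] {e z : E} {g : E → ℂ} {k : ℕ}

/-- The operator `1 - ∂ₑ`. -/
def oneSubLineDeriv (e : E) (g : E → ℂ) (z : E) : ℂ := g z - lineDeriv ℝ g z e

lemma oneSubLineDeriv_eq_fderiv (hg : Differentiable ℝ g) :
    oneSubLineDeriv e g = fun z => g z - fderiv ℝ g z e :=
  funext fun z => by rw [oneSubLineDeriv, (hg z).lineDeriv_eq_fderiv]

lemma ContDiff.oneSubLineDeriv (hg : ContDiff ℝ ∞ g) : ContDiff ℝ ∞ (oneSubLineDeriv e g) := by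
  rw [oneSubLineDeriv_eq_fderiv (hg.differentiable (by simp))]
  exact hg.sub ((hg.fderiv_right (m := ∞) (by simp)).clm_apply contDiff_const)

lemma ContDiff.iterate_oneSubLineDeriv (hg : ContDiff ℝ ∞ g) (k : ℕ) :
    ContDiff ℝ ∞ ((_root_.oneSubLineDeriv e)^[k] g) := by
  induction k with
  | zero => exact hg
  | succ k ih =>
    rw [Function.iterate_succ_apply']
    exact ih.oneSubLineDeriv

lemma tsupport_oneSubLineDeriv_subset (hg : ContDiff ℝ ∞ g) :
    tsupport (oneSubLineDeriv e g) ⊆ tsupport g := by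
  rw [oneSubLineDeriv_eq_fderiv (hg.differentiable (by simp))]
  exact (tsupport_sub _ _).trans (union_subset subset_rfl (tsupport_fderiv_apply_subset ℝ e))

lemma tsupport_iterate_oneSubLineDeriv_subset (hg : ContDiff ℝ ∞ g) (k : ℕ) :
    tsupport ((oneSubLineDeriv e)^[k] g) ⊆ tsupport g := by
  induction k with
  | zero => exact subset_rfl
  | succ k ih =>
    rw [Function.iterate_succ_apply']
    exact (tsupport_oneSubLineDeriv_subset (hg.iterate_oneSubLineDeriv k)).trans ih

lemma norm_iteratedFDeriv_oneSubLineDeriv_le (hg : ContDiff ℝ ∞ g) (he : ‖e‖ ≤ 1) {M : ℝ}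
    (hM : ∀ j ≤ k + 1, ‖iteratedFDeriv ℝ j g z‖ ≤ M) {j : ℕ} (hj : j ≤ k) :
    ‖iteratedFDeriv ℝ j (oneSubLineDeriv e g) z‖ ≤ 2 * M := by
  have hd : ContDiff ℝ ∞ (fderiv ℝ g) := hg.fderiv_right (by simp)
  have hde : ContDiff ℝ ∞ (fun z => fderiv ℝ g z e) := hd.clm_apply contDiff_const
  have hjt : (j : ℕ∞ω) ≤ ∞ := by exact_mod_cast le_top
  rw [oneSubLineDeriv_eq_fderiv (hg.differentiable (by simp)),
    fun_iteratedFDeriv_sub_apply (hg.of_le hjt).contDiffAt (hde.of_le hjt).contDiffAt]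
  have h1 : ‖iteratedFDeriv ℝ j (fun z => fderiv ℝ g z e) z‖ ≤ M := by
    refine (norm_iteratedFDeriv_clm_apply_const hd.contDiffAt hjt).trans ?_
    rw [norm_iteratedFDeriv_fderiv]
    have := hM (j + 1) (by omega)
    nlinarith [norm_nonneg (iteratedFDeriv ℝ (j + 1) g z)]
  calc _ ≤ _ := norm_sub_le _ _
    _ ≤ M + M := add_le_add (hM j (by omega)) h1
    _ = 2 * M := by ring

lemma norm_iterate_oneSubLineDeriv_le (hg : ContDiff ℝ ∞ g) (he : ‖e‖ ≤ 1) {M : ℝ}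
    (hM : ∀ j ≤ k, ‖iteratedFDeriv ℝ j g z‖ ≤ M) :
    ‖(oneSubLineDeriv e)^[k] g z‖ ≤ 2 ^ k * M := by
  induction k generalizing g M with
  | zero => simpa using hM 0 le_rfl
  | succ k ih =>
    rw [Function.iterate_succ_apply]
    refine (ih hg.oneSubLineDeriv fun j hj =>
      norm_iteratedFDeriv_oneSubLineDeriv_le hg he hM hj).trans_eq ?_
    ring

/-- The direction has no frequency component. Derivatives can thus be taken at frozen `θ`, which is
where the symbol estimates apply. -/
lemma iterate_oneSubLineDeriv_slice (H : E × E' → ℂ) (k : ℕ) (z : E) (θ : E') :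
    (oneSubLineDeriv (e, (0 : E')))^[k] H (z, θ) =
      (oneSubLineDeriv e)^[k] (fun z' => H (z', θ)) z := by
  induction k generalizing H with
  | zero => rfl
  | succ k ih =>
    rw [Function.iterate_succ_apply, Function.iterate_succ_apply, ih]
    refine congrArg (fun G => (oneSubLineDeriv e)^[k] G z) (funext fun z' => ?_)
    simp [oneSubLineDeriv, lineDeriv]

lemma oneSubLineDeriv_mul_snd (c : E' → ℂ) (H : E × E' → ℂ) :
    oneSubLineDeriv (e, (0 : E')) (fun p => c p.2 * H p) =
      fun p => c p.2 * oneSubLineDeriv (e, (0 : E')) H p := by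
  ext p
  simp only [oneSubLineDeriv, lineDeriv, mul_sub]
  congr 1
  simp

end OneSubLineDeriv

/-! ### Integration by parts in an oscillatory integral -/

section IntegrationByParts

variable {m n : ℕ} {φ : PhaseDomain m n 1 → ℝ} {e : (Fin m → ℝ) × (Fin n → ℝ)}

instance : (volume : Measure ((Fin m → ℝ) × (Fin n → ℝ))).IsAddHaarMeasure :=
  Measure.prod.instIsAddHaarMeasure (volume : Measure (Fin m → ℝ)) (volume : Measure (Fin n → ℝ))

instance : (volume : Measure (PhaseDomain m n 1)).IsAddHaarMeasure :=
  Measure.prod.instIsAddHaarMeasure (volume : Measure ((Fin m → ℝ) × (Fin n → ℝ)))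
    (volume : Measure (Fin 1 → ℝ))

/-- The factor `(1 - iω)⁻¹` gained by one integration by parts. -/
def freqGain (θ : Fin 1 → ℝ) : ℂ := (1 - Complex.I * (θ 0 : ℂ))⁻¹

lemma one_sub_I_mul_ne_zero (r : ℝ) : (1 - Complex.I * (r : ℂ)) ≠ 0 := fun H => by
  simpa using congrArg Complex.re H

lemma contDiff_freqGain : ContDiff ℝ ∞ freqGain := by
  refine ContDiff.inv ?_ fun θ => one_sub_I_mul_ne_zero _
  refine contDiff_const.sub (contDiff_const.mul ?_)
  exact Complex.ofRealCLM.contDiff.comp (contDiff_apply ℝ ℝ 0)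

lemma norm_fin_one (θ : Fin 1 → ℝ) : ‖θ‖ = |θ 0| := by
  simp [Pi.norm_def, Finset.univ_unique]

lemma norm_freqGain_pow_four_le (θ : Fin 1 → ℝ) : ‖freqGain θ‖ ^ 4 ≤ 4 * (1 + ‖θ‖) ^ (-4 : ℝ) := by
  have h1 : ‖(1 - Complex.I * (θ 0 : ℂ))‖ ^ 2 = 1 + θ 0 ^ 2 := by
    rw [← Complex.normSq_eq_norm_sq, Complex.normSq_apply]
    simp
    ring
  have h2 : (1 + ‖θ‖) ^ 4 ≤ 4 * ‖(1 - Complex.I * (θ 0 : ℂ))‖ ^ 4 := by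
    rw [show ‖(1 - Complex.I * (θ 0 : ℂ))‖ ^ 4 = (‖(1 - Complex.I * (θ 0 : ℂ))‖ ^ 2) ^ 2 by ring,
      h1, norm_fin_one]
    have h3 : (1 + |θ 0|) ^ 2 ≤ 2 * (1 + θ 0 ^ 2) := by
      nlinarith [sq_nonneg (1 - |θ 0|), sq_abs (θ 0)]
    calc (1 + |θ 0|) ^ 4 = ((1 + |θ 0|) ^ 2) ^ 2 := by ring
      _ ≤ (2 * (1 + θ 0 ^ 2)) ^ 2 := by gcongr
      _ = _ := by ring
  have h4 : 0 < ‖(1 - Complex.I * (θ 0 : ℂ))‖ := norm_pos_iff.2 (one_sub_I_mul_ne_zero _)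
  have h5 : 0 < 1 + ‖θ‖ := by positivity
  rw [freqGain, norm_inv, Real.rpow_neg h5.le]
  norm_cast
  rw [inv_pow, inv_eq_one_div, ← div_eq_mul_inv, div_le_div_iff₀ (by positivity) (by positivity)]
  simpa using h2

lemma contDiff_cexp_phase (hφ : ContDiff ℝ ∞ φ) :
    ContDiff ℝ ∞ (fun p => Complex.exp (Complex.I * (φ p : ℂ))) :=
  Complex.contDiff_exp.comp (contDiff_const.mul (Complex.ofRealCLM.contDiff.comp hφ))

lemma fderiv_cexp_phase (hφ : ContDiff ℝ ∞ φ)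
    (hφe : ∀ p, fderiv ℝ φ p (e, 0) = -(p.2 0)) (p : PhaseDomain m n 1) :
    fderiv ℝ (fun p => Complex.exp (Complex.I * (φ p : ℂ))) p (e, 0) =
      Complex.exp (Complex.I * (φ p : ℂ)) * (-(Complex.I * (p.2 0 : ℂ))) := by
  have h1 := (hφ.differentiable (by simp) p).hasFDerivAt
  have h2 := ((Complex.ofRealCLM.hasFDerivAt.comp p h1).const_mul Complex.I).cexp
  have h3 := congrArg (fun L : _ →L[ℝ] ℂ => L (e, 0)) h2.fderiv
  refine h3.trans ?_
  simp [hφe]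

/-- One integration by parts in the direction `e`, in which the phase is linear with slope `-ω`. -/
lemma integral_cexp_phase_mul_eq (hφ : ContDiff ℝ ∞ φ)
    (hφe : ∀ p, fderiv ℝ φ p (e, 0) = -(p.2 0)) {G : PhaseDomain m n 1 → ℂ}
    (hG : ContDiff ℝ ∞ G) (hGs : HasCompactSupport G) :
    ∫ p, Complex.exp (Complex.I * (φ p : ℂ)) * G p =
      ∫ p, Complex.exp (Complex.I * (φ p : ℂ)) *
        (freqGain p.2 * oneSubLineDeriv (e, (0 : Fin 1 → ℝ)) G p) := by
  set u : PhaseDomain m n 1 → ℂ := fun p => Complex.exp (Complex.I * (φ p : ℂ))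
  have hu : ContDiff ℝ ∞ u := contDiff_cexp_phase hφ
  set G' : PhaseDomain m n 1 → ℂ := fun p => freqGain p.2 * G p
  have hG' : ContDiff ℝ ∞ G' := (contDiff_freqGain.comp contDiff_snd).mul hG
  have hG's : HasCompactSupport G' := hGs.mul_left
  have hdG' : Continuous fun p => fderiv ℝ G' p (e, 0) :=
    (hG'.continuous_fderiv (by simp)).clm_apply continuous_const
  have hdu : Continuous fun p => fderiv ℝ u p (e, 0) :=
    (hu.continuous_fderiv (by simp)).clm_apply continuous_const
  have i1 : Integrable (fun p => u p * fderiv ℝ G' p (e, 0)) :=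
    (hu.continuous.mul hdG').integrable_of_hasCompactSupport
      ((hG's.fderiv_apply ℝ (e, 0)).mul_left)
  have i2 : Integrable (fun p => fderiv ℝ u p (e, 0) * G' p) :=
    (hdu.mul hG'.continuous).integrable_of_hasCompactSupport hG's.mul_left
  have i3 : Integrable (fun p => u p * G' p) :=
    (hu.continuous.mul hG'.continuous).integrable_of_hasCompactSupport hG's.mul_left
  have ibp := integral_mul_fderiv_eq_neg_fderiv_mul_of_integrable i2 i1 i3
    (fun p _ => hu.differentiable (by simp) p) (fun p _ => hG'.differentiable (by simp) p)
  have e1 : ∀ p : PhaseDomain m n 1, u p * (freqGain p.2 * oneSubLineDeriv (e, (0 : Fin 1 → ℝ)) G p)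
      = u p * G' p - u p * fderiv ℝ G' p (e, 0) := fun p => by
    rw [← congrFun (oneSubLineDeriv_mul_snd freqGain G) p,
      oneSubLineDeriv_eq_fderiv (hG'.differentiable (by simp)), mul_sub]
  -- This is `(1 + ∂ₑ) u = (1 - iω) u`, with the factor `1 - iω` cancelled by `freqGain`. The
  -- transpose of `1 + ∂ₑ` is `1 - ∂ₑ`.
  have e2 : ∀ p, u p * G p = u p * G' p + fderiv ℝ u p (e, 0) * G' p := fun p => by
    rw [fderiv_cexp_phase hφ hφe]
    simp only [G', freqGain, u]
    have := one_sub_I_mul_ne_zero (p.2 0)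
    field_simp
    ring
  rw [integral_congr_ae (.of_forall e1), integral_congr_ae (.of_forall e2), integral_sub i3 i1,
    integral_add i3 i2, ibp, sub_neg_eq_add]

/-- The frequency factor `c` commutes with `1 - ∂ₑ`, so derivatives never fall on the cutoff. The
induction varies `c` in order to absorb each new `freqGain` into it. -/
lemma integral_cexp_phase_mul_eq_iterate (hφ : ContDiff ℝ ∞ φ)
    (hφe : ∀ p, fderiv ℝ φ p (e, 0) = -(p.2 0)) {H : PhaseDomain m n 1 → ℂ}
    (hH : ContDiff ℝ ∞ H) {K : Set ((Fin m → ℝ) × (Fin n → ℝ))} (hK : IsCompact K)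
    (hHs : tsupport H ⊆ K ×ˢ univ) {c : (Fin 1 → ℝ) → ℂ} (hc : ContDiff ℝ ∞ c)
    (hcs : HasCompactSupport c) (k : ℕ) :
    ∫ p, Complex.exp (Complex.I * (φ p : ℂ)) * (c p.2 * H p) =
      ∫ p, Complex.exp (Complex.I * (φ p : ℂ)) *
        (c p.2 * (freqGain p.2 ^ k * (oneSubLineDeriv (e, (0 : Fin 1 → ℝ)))^[k] H p)) := by
  induction k generalizing H c with
  | zero => simp
  | succ k ih =>
    have hs : HasCompactSupport fun p : PhaseDomain m n 1 => c p.2 * H p := by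
      refine HasCompactSupport.of_support_subset_isCompact (hK.prod hcs) fun p hp => ⟨?_, ?_⟩
      · exact (hHs (subset_tsupport _ (right_ne_zero_of_mul hp))).1
      · exact subset_tsupport _ (left_ne_zero_of_mul hp)
    have hcH : ContDiff ℝ ∞ fun p : PhaseDomain m n 1 => c p.2 * H p :=
      (hc.comp contDiff_snd).mul hH
    rw [integral_cexp_phase_mul_eq hφ hφe hcH hs]
    have hc' : ContDiff ℝ ∞ fun θ => c θ * freqGain θ := hc.mul contDiff_freqGain
    have := ih (hH.oneSubLineDeriv (e := (e, (0 : Fin 1 → ℝ)))) ((tsupport_oneSubLineDeriv_subset hH).trans hHs) hc'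
      (hcs.mul_right (f' := freqGain))
    simp only [Function.iterate_succ_apply, oneSubLineDeriv_mul_snd c H, pow_succ]
    convert this using 4 <;> ring

end IntegrationByParts

/-! ### Symbols against test functions -/

lemma tsupport_smul_subset_prod {E : Type*} [TopologicalSpace E] {N : ℕ} (w : E → ℝ)
    (a : E × (Fin N → ℝ) → ℂ) :
    tsupport (fun p => w p.1 • a p) ⊆ tsupport w ×ˢ univ :=
  closure_minimal (fun _ hp => ⟨subset_tsupport _ (left_ne_zero_of_smul hp), mem_univ _⟩)
    ((isClosed_tsupport w).prod isClosed_univ)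

section SymbolBounds

variable {E : Type*} [NormedAddCommGroup E] [NormedSpace ℝ E] {N : ℕ} {Z K : Set E} {μ : ℝ}
  {a : E × (Fin N → ℝ) → ℂ} {w : E → ℝ}

lemma contDiff_smul_of_tsupport_subset (hZ : IsOpen Z) (ha : ContDiffOn ℝ ∞ a (Z ×ˢ univ))
    (hw : ContDiff ℝ ∞ w) (hwZ : tsupport w ⊆ Z) : ContDiff ℝ ∞ fun p => w p.1 • a p := by
  rw [contDiff_iff_contDiffAt]
  intro p
  by_cases hp : p.1 ∈ tsupport w
  · have ha' : ContDiffAt ℝ ∞ a p :=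
      ha.contDiffAt ((hZ.prod isOpen_univ).mem_nhds ⟨hwZ hp, mem_univ _⟩)
    exact (hw.comp contDiff_fst).contDiffAt.smul ha'
  · have h0 : (fun p : E × (Fin N → ℝ) => w p.1 • a p) =ᶠ[𝓝 p] fun _ => 0 := by
      have : ∀ᶠ z in 𝓝 p.1, w z = 0 := by
        filter_upwards [(isClosed_tsupport w).isOpen_compl.mem_nhds hp] with z hz
        exact image_eq_zero_of_notMem_tsupport hz
      filter_upwards [continuous_fst.continuousAt.eventually this] with q hq
      rw [hq, zero_smul]
    exact contDiffAt_const.congr_of_eventuallyEq h0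

lemma exists_forall_le_bound (c : ℕ → ℝ) (k : ℕ) : ∃ C, 0 ≤ C ∧ ∀ j ≤ k, c j ≤ C := by
  refine ⟨∑ j ∈ Finset.range (k + 1), |c j|, Finset.sum_nonneg fun j _ => abs_nonneg _,
    fun j hj => (le_abs_self _).trans ?_⟩
  exact Finset.single_le_sum (f := fun j => |c j|) (fun i _ => abs_nonneg _)
    (Finset.mem_range.2 (by omega))

lemma IsSymbol.exists_bound_iteratedFDeriv (ha : IsSymbol Z μ a) (hKZ : K ⊆ Z) (hK : IsCompact K)
    (k l : ℕ) : ∃ C, 0 ≤ C ∧ ∀ z ∈ K, ∀ θ, ∀ j ≤ k,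
      ‖iteratedFDeriv ℝ j (fun z' => iteratedFDeriv ℝ l (fun θ' => a (z', θ')) θ) z‖
        ≤ C * (1 + ‖θ‖) ^ (μ - l) := by
  choose c hc using fun j => ha.2 K hKZ hK j l
  obtain ⟨C, hC, hcC⟩ := exists_forall_le_bound c k
  exact ⟨C, hC, fun z hz θ j hj => (hc j z hz θ).trans
    (mul_le_mul_of_nonneg_right (hcC j hj) (by positivity))⟩

lemma IsSymbol.exists_bound (ha : IsSymbol Z μ a) (hKZ : K ⊆ Z) (hK : IsCompact K) (k : ℕ) :
    ∃ C, 0 ≤ C ∧ ∀ z ∈ K, ∀ θ, ∀ j ≤ k,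
      ‖iteratedFDeriv ℝ j (fun z' => a (z', θ)) z‖ ≤ C * (1 + ‖θ‖) ^ μ := by
  obtain ⟨C, hC, h⟩ := ha.exists_bound_iteratedFDeriv hKZ hK k 0
  refine ⟨C, hC, fun z hz θ j hj => ?_⟩
  have h1 : (fun z' => iteratedFDeriv ℝ 0 (fun θ' => a (z', θ')) θ) =
      (continuousMultilinearCurryFin0 ℝ (Fin N → ℝ) ℂ).symm ∘ fun z' => a (z', θ) :=
    funext fun z' => by rw [iteratedFDeriv_zero_eq_comp]; rfl
  simpa only [h1, LinearIsometryEquiv.norm_iteratedFDeriv_comp_left, Nat.cast_zero, sub_zero]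
    using h z hz θ j hj

lemma norm_iteratedFDeriv_smul_le_of_le {F : Type*} [NormedAddCommGroup F] [NormedSpace ℝ F]
    (hZ : IsOpen Z) {g : E → F} (hw : ContDiffOn ℝ ∞ w Z)
    (hg : ContDiffOn ℝ ∞ g Z) {z : E} (hz : z ∈ Z) {A B : ℝ} {k : ℕ} (hA : 0 ≤ A)
    (hwA : ∀ j ≤ k, ‖iteratedFDeriv ℝ j w z‖ ≤ A) (hgB : ∀ j ≤ k, ‖iteratedFDeriv ℝ j g z‖ ≤ B)
    {j : ℕ} (hj : j ≤ k) :
    ‖iteratedFDeriv ℝ j (fun z => w z • g z) z‖ ≤ 2 ^ k * (A * B) := by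
  have hB : 0 ≤ B := (norm_nonneg _).trans (hgB 0 (Nat.zero_le _))
  have h1 := norm_iteratedFDerivWithin_smul_le hw hg hZ.uniqueDiffOn hz
    (n := j) (by exact_mod_cast le_top)
  simp only [iteratedFDerivWithin_of_isOpen _ hZ hz] at h1
  calc _ ≤ _ := h1
    _ ≤ ∑ i ∈ Finset.range (j + 1), (j.choose i : ℝ) * (A * B) := by
      refine Finset.sum_le_sum fun i hi => ?_
      rw [Finset.mem_range] at hi
      rw [mul_assoc]
      exact mul_le_mul_of_nonneg_left (mul_le_mul (hwA i (by omega)) (hgB (j - i) (by omega))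
        (norm_nonneg _) hA) (Nat.cast_nonneg _)
    _ = 2 ^ j * (A * B) := by
      rw [← Finset.sum_mul]
      congr 1
      exact_mod_cast Nat.sum_range_choose j
    _ ≤ 2 ^ k * (A * B) :=
      mul_le_mul_of_nonneg_right (pow_le_pow_right₀ one_le_two hj) (mul_nonneg hA hB)

end SymbolBounds

/-! ### The limit of the regularized integrals -/

section OscillatoryPairing

variable {m n : ℕ} {φ : PhaseDomain m n 1 → ℝ} {e : (Fin m → ℝ) × (Fin n → ℝ)}
  {Z K : Set ((Fin m → ℝ) × (Fin n → ℝ))} {a : PhaseDomain m n 1 → ℂ}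
  {w : (Fin m → ℝ) × (Fin n → ℝ) → ℝ}

/-- The absolutely convergent integrand obtained from `exp(i φ) a w` by four integrations by parts
in the direction `e`. -/
def reducedIntegrand (e : (Fin m → ℝ) × (Fin n → ℝ)) (φ : PhaseDomain m n 1 → ℝ)
    (a : PhaseDomain m n 1 → ℂ) (w : (Fin m → ℝ) × (Fin n → ℝ) → ℝ) (p : PhaseDomain m n 1) : ℂ :=
  Complex.exp (Complex.I * (φ p : ℂ)) * (freqGain p.2 ^ 4 *
    (oneSubLineDeriv (e, (0 : Fin 1 → ℝ)))^[4] (fun p => w p.1 • a p) p)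

/-- The integrable majorant of `reducedIntegrand`. -/
def majorant (K : Set ((Fin m → ℝ) × (Fin n → ℝ))) (C : ℝ) (p : PhaseDomain m n 1) : ℝ :=
  K.indicator (fun _ => C) p.1 * (1 + ‖p.2‖) ^ (-2 : ℝ)

lemma integrable_majorant (hK : IsCompact K) (C : ℝ) : Integrable (majorant K C) := by
  have h1 : Integrable (K.indicator fun _ => C) :=
    (integrable_indicator_iff hK.measurableSet).2
      (integrableOn_const hK.measure_lt_top.ne)
  have h2 : Integrable (fun θ : Fin 1 → ℝ => (1 + ‖θ‖) ^ (-2 : ℝ)) :=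
    integrable_one_add_norm (by simp)
  exact h1.mul_prod h2

lemma norm_cexp_I_mul_ofReal (r : ℝ) : ‖Complex.exp (Complex.I * (r : ℂ))‖ = 1 := by
  rw [mul_comm, Complex.norm_exp_ofReal_mul_I]

/-- The reduced integrand is dominated, uniformly in terms of the first four derivatives of the
test function. -/
lemma exists_norm_reducedIntegrand_le (hZ : IsOpen Z) (ha : IsSymbol Z 2 a) (he : ‖e‖ ≤ 1)
    (φ : PhaseDomain m n 1 → ℝ) (hKZ : K ⊆ Z) (hK : IsCompact K) :
    ∃ C, 0 ≤ C ∧ ∀ w : (Fin m → ℝ) × (Fin n → ℝ) → ℝ, ContDiff ℝ ∞ w → tsupport w ⊆ K →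
      ∀ B, (∀ j ≤ 4, ∀ z, ‖iteratedFDeriv ℝ j w z‖ ≤ B) → ∀ p,
        ‖reducedIntegrand e φ a w p‖ ≤ majorant K (C * B) p := by
  obtain ⟨C, hC, hb⟩ := ha.exists_bound hKZ hK 4
  -- `1024 = 4 · 2⁴ · 2⁴`: the bound on `freqGain ^ 4`, the four applications of `1 - ∂ₑ`, and the
  -- Leibniz rule for `w a`.
  refine ⟨1024 * C, by positivity, fun w hw hwK B hB p => ?_⟩
  have hB0 : 0 ≤ B := (norm_nonneg _).trans (hB 0 (by norm_num) 0)
  have hsm : ContDiff ℝ ∞ fun p => w p.1 • a p :=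
    contDiff_smul_of_tsupport_subset hZ ha.1 hw (hwK.trans hKZ)
  by_cases hp : p.1 ∈ K
  · have hslice : ContDiffOn ℝ ∞ (fun z => a (z, p.2)) Z :=
      ha.1.comp (contDiff_id.prodMk contDiff_const).contDiffOn fun z hz => ⟨hz, mem_univ _⟩
    have h1 : ∀ j ≤ 4, ‖iteratedFDeriv ℝ j (fun z => w z • a (z, p.2)) p.1‖ ≤
        2 ^ 4 * (B * (C * (1 + ‖p.2‖) ^ (2 : ℝ))) := fun j hj =>
      norm_iteratedFDeriv_smul_le_of_le hZ hw.contDiffOn hslice (hKZ hp) hB0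
        (fun i hi => hB i hi p.1) (fun i hi => hb p.1 hp p.2 i hi) hj
    have hsm' : ContDiff ℝ ∞ fun z => w z • a (z, p.2) :=
      hsm.comp (contDiff_id.prodMk contDiff_const)
    have h2 := norm_iterate_oneSubLineDeriv_le hsm' he h1
    have h3 := norm_freqGain_pow_four_le p.2
    have h4 : (1 + ‖p.2‖) ^ (-4 : ℝ) * (1 + ‖p.2‖) ^ (2 : ℝ) = (1 + ‖p.2‖) ^ (-2 : ℝ) := by
      rw [← Real.rpow_add (by positivity)]
      norm_num
    rw [reducedIntegrand, norm_mul, norm_cexp_I_mul_ofReal, one_mul, norm_mul, norm_pow,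
      ← Prod.mk.eta (p := p), iterate_oneSubLineDeriv_slice, majorant, indicator_of_mem hp]
    calc _ ≤ 4 * (1 + ‖p.2‖) ^ (-4 : ℝ) * (2 ^ 4 * (2 ^ 4 * (B * (C * (1 + ‖p.2‖) ^ (2 : ℝ))))) :=
          mul_le_mul h3 h2 (norm_nonneg _) (by positivity)
      _ = 1024 * C * B * ((1 + ‖p.2‖) ^ (-4 : ℝ) * (1 + ‖p.2‖) ^ (2 : ℝ)) := by ring
      _ = _ := by rw [h4]
  · have h0 : (oneSubLineDeriv (e, (0 : Fin 1 → ℝ)))^[4] (fun p => w p.1 • a p) p = 0 :=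
      image_eq_zero_of_notMem_tsupport fun H =>
        hp (hwK (tsupport_smul_subset_prod w a
          (tsupport_iterate_oneSubLineDeriv_subset hsm 4 H)).1)
    rw [reducedIntegrand, h0, majorant, indicator_of_notMem hp]
    simp

lemma exists_forall_norm_iteratedFDeriv_le {E F : Type*} [NormedAddCommGroup E] [NormedSpace ℝ E]
    [NormedAddCommGroup F] [NormedSpace ℝ F] {g : E → F} (hg : ContDiff ℝ ∞ g)
    (hgs : HasCompactSupport g) (k : ℕ) :
    ∃ B, 0 ≤ B ∧ ∀ j ≤ k, ∀ z, ‖iteratedFDeriv ℝ j g z‖ ≤ B := by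
  have h (j : ℕ) : ∃ B, ∀ z, ‖iteratedFDeriv ℝ j g z‖ ≤ B :=
    (hg.continuous_iteratedFDeriv (by exact_mod_cast le_top)).bounded_above_of_compact_support
      (hgs.iteratedFDeriv j)
  choose b hb using h
  obtain ⟨B, hB0, hB⟩ := exists_forall_le_bound b k
  exact ⟨B, hB0, fun j hj z => (hb j z).trans (hB j hj)⟩

lemma continuous_reducedIntegrand (hφ : ContDiff ℝ ∞ φ)
    (hsm : ContDiff ℝ ∞ fun p => w p.1 • a p) : Continuous (reducedIntegrand e φ a w) :=
  (contDiff_cexp_phase hφ).continuous.mul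
    (((contDiff_freqGain.continuous.comp continuous_snd).pow 4).mul
      (hsm.iterate_oneSubLineDeriv 4).continuous)

/-- The regularized integrals converge, to the integral of the reduced integrand. -/
theorem tendsto_regularizedIntegral (hZ : IsOpen Z) (ha : IsSymbol Z 2 a) (he : ‖e‖ ≤ 1)
    (hφ : ContDiff ℝ ∞ φ) (hφe : ∀ p, fderiv ℝ φ p (e, 0) = -(p.2 0)) (hw : ContDiff ℝ ∞ w)
    (hws : HasCompactSupport w) (hwZ : tsupport w ⊆ Z) {χ : (Fin 1 → ℝ) → ℝ}
    (hχ : IsFrequencyCutoff χ) :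
    Tendsto (regularizedIntegral φ a χ w) (𝓝[>] 0) (𝓝 (∫ p, reducedIntegrand e φ a w p)) := by
  have hsm := contDiff_smul_of_tsupport_subset hZ ha.1 hw hwZ
  obtain ⟨C, hC, hb⟩ := exists_norm_reducedIntegrand_le hZ ha he φ hwZ hws
  obtain ⟨B, -, hB⟩ := exists_forall_norm_iteratedFDeriv_le hw hws 4
  obtain ⟨M, hM⟩ := hχ.1.continuous.bounded_above_of_compact_support hχ.2.1
  have key : ∀ ε : ℝ, 0 < ε → regularizedIntegral φ a χ w ε =
      ∫ p : PhaseDomain m n 1, (χ (ε • p.2) : ℂ) * reducedIntegrand e φ a w p := by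
    intro ε hε
    have hc : ContDiff ℝ ∞ fun θ : Fin 1 → ℝ => (χ (ε • θ) : ℂ) :=
      Complex.ofRealCLM.contDiff.comp (hχ.1.comp (contDiff_const_smul ε))
    have hcs : HasCompactSupport fun θ : Fin 1 → ℝ => (χ (ε • θ) : ℂ) :=
      (hχ.2.1.comp_homeomorph (Homeomorph.smulOfNeZero ε hε.ne')).comp_left
        (g := fun r : ℝ => (r : ℂ)) (by simp)
    have := integral_cexp_phase_mul_eq_iterate hφ hφe hsm hws (tsupport_smul_subset_prod w a)
      hc hcs 4
    rw [regularizedIntegral]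
    refine Eq.trans (integral_congr_ae (.of_forall fun p => ?_)) (this.trans
      (integral_congr_ae (.of_forall fun p => ?_)))
    · simp only [Complex.real_smul]
      ring
    · simp only [reducedIntegrand]
      ring
  -- Dominated convergence: `χ` is bounded, and for each frequency `χ (ε θ) = 1` once `ε` is small.
  -- The limit therefore does not depend on `χ`.
  refine Tendsto.congr' (eventually_mem_nhdsWithin.mono fun ε hε => (key ε hε).symm) ?_
  refine tendsto_integral_filter_of_dominated_convergence
    (fun p => M * majorant (tsupport w) (C * B) p) ?_ ?_
    ((integrable_majorant hws _).const_mul M) (.of_forall fun p => ?_)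
  · refine .of_forall fun ε => Continuous.aestronglyMeasurable ?_
    refine Continuous.mul ?_ (continuous_reducedIntegrand hφ hsm)
    exact Complex.continuous_ofReal.comp
      (hχ.1.continuous.comp (continuous_snd.const_smul ε))
  · refine .of_forall fun ε => .of_forall fun p => ?_
    rw [norm_mul, Complex.norm_real]
    exact mul_le_mul (hM _) (hb w hw subset_rfl B hB p) (norm_nonneg _)
      ((norm_nonneg _).trans (hM 0))
  · have h1 : Tendsto (fun ε : ℝ => ε • p.2) (𝓝[>] 0) (𝓝 0) := by
      refine tendsto_nhdsWithin_of_tendsto_nhds ?_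
      exact (continuous_id.smul continuous_const).tendsto' 0 0 (by simp)
    have h2 : ∀ᶠ ε in 𝓝[>] (0 : ℝ), χ (ε • p.2) = 1 := h1.eventually hχ.2.2
    refine tendsto_const_nhds.congr' (h2.mono fun ε hε => ?_)
    simp only [hε, Complex.ofReal_one, one_mul]

/-- The limit of the regularized integrals is bounded by the first four derivatives of the test
function. -/
lemma exists_norm_integral_reducedIntegrand_le (hZ : IsOpen Z) (ha : IsSymbol Z 2 a)
    (he : ‖e‖ ≤ 1) (φ : PhaseDomain m n 1 → ℝ) (hKZ : K ⊆ Z) (hK : IsCompact K) :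
    ∃ D, 0 ≤ D ∧ ∀ w : (Fin m → ℝ) × (Fin n → ℝ) → ℝ, ContDiff ℝ ∞ w → tsupport w ⊆ K →
      ∀ B, (∀ j ≤ 4, ∀ z, ‖iteratedFDeriv ℝ j w z‖ ≤ B) →
        ‖∫ p, reducedIntegrand e φ a w p‖ ≤ D * B := by
  obtain ⟨C, hC, hb⟩ := exists_norm_reducedIntegrand_le hZ ha he φ hKZ hK
  refine ⟨∫ p : PhaseDomain m n 1, majorant K C p, integral_nonneg fun p => ?_,
    fun w hw hwK B hB => ?_⟩
  · exact mul_nonneg (indicator_nonneg (fun _ _ => hC) _) (by positivity)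
  · refine (norm_integral_le_of_norm_le (integrable_majorant hK (C * B))
      (.of_forall (hb w hw hwK B hB))).trans_eq ?_
    rw [← integral_mul_const]
    refine integral_congr_ae (.of_forall fun p => ?_)
    by_cases hp : p.1 ∈ K <;> simp [majorant, hp]
    ring

end OscillatoryPairing

/-! ### Multiplying a symbol by a smooth function -/

section SymbolSmul

variable {E : Type*} [NormedAddCommGroup E] [NormedSpace ℝ E] {N : ℕ} {Z : Set E} {μ : ℝ}
  {a : E × (Fin N → ℝ) → ℂ} {ρ : E → ℝ}

/-- Joint smoothness allows the Leibniz rule in `z` to be applied to a `θ`-derivative of the symbol,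
as in `IsSymbol.smul`. -/
lemma contDiffOn_iteratedFDeriv_snd (hZ : IsOpen Z) (ha : ContDiffOn ℝ ∞ a (Z ×ˢ univ)) (l : ℕ) :
    ContDiffOn ℝ ∞ (fun p : E × (Fin N → ℝ) => iteratedFDeriv ℝ l (fun θ => a (p.1, θ)) p.2)
      (Z ×ˢ univ) := by
  induction l with
  | zero =>
    have : (fun p : E × (Fin N → ℝ) => iteratedFDeriv ℝ 0 (fun θ => a (p.1, θ)) p.2) =
        (continuousMultilinearCurryFin0 ℝ (Fin N → ℝ) ℂ).symm ∘ a :=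
      funext fun p => by rw [iteratedFDeriv_zero_eq_comp]; rfl
    rw [this]
    exact (LinearIsometryEquiv.contDiff _).comp_contDiffOn ha
  | succ l ih =>
    have hopen : IsOpen (Z ×ˢ (univ : Set (Fin N → ℝ))) := hZ.prod isOpen_univ
    intro p hp
    have h1 : ContDiffAt ℝ ∞
        (fun p : E × (Fin N → ℝ) => iteratedFDeriv ℝ l (fun θ => a (p.1, θ)) p.2) (p.1, p.2) :=
      ih.contDiffAt (hopen.mem_nhds hp)
    have h2 : ContDiffAt ℝ ∞ (fun p : E × (Fin N → ℝ) =>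
        fderiv ℝ (iteratedFDeriv ℝ l (fun θ' => a (p.1, θ'))) p.2) p :=
      ContDiffAt.fderiv (n := ∞)
        (f := fun (p : E × (Fin N → ℝ)) θ => iteratedFDeriv ℝ l (fun θ' => a (p.1, θ')) θ)
        (g := Prod.snd) (h1.comp (p, p.2)
          (f := fun q : (E × (Fin N → ℝ)) × (Fin N → ℝ) => (q.1.1, q.2)) (by fun_prop))
        contDiff_snd.contDiffAt (by simp)
    exact (h2.continuousLinearMap_comp
      ((continuousMultilinearCurryLeftEquiv ℝ (fun _ : Fin (l + 1) => Fin N → ℝ) ℂ).symm :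
        _ →L[ℝ] (Fin N → ℝ) [×(l + 1)]→L[ℝ] ℂ)).contDiffWithinAt

/-- Since `ρ` does not depend on `θ`, it passes through the `θ`-derivatives; its own derivatives are
bounded on compact sets, so the order is unchanged. -/
lemma IsSymbol.smul (hZ : IsOpen Z) (ha : IsSymbol Z μ a) (hρ : ContDiff ℝ ∞ ρ) :
    IsSymbol Z μ fun p => ρ p.1 • a p := by
  refine ⟨(hρ.comp contDiff_fst).contDiffOn.smul ha.1, fun K hKZ hK j l => ?_⟩
  obtain ⟨C, hC, hb⟩ := ha.exists_bound_iteratedFDeriv hKZ hK j l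
  have hρb (i : ℕ) : ∃ A, ∀ z ∈ K, ‖iteratedFDeriv ℝ i ρ z‖ ≤ A :=
    hK.exists_bound_of_continuousOn
      (hρ.continuous_iteratedFDeriv (by exact_mod_cast le_top)).continuousOn
  choose A hA using hρb
  obtain ⟨A', hA0, hA'⟩ := exists_forall_le_bound A j
  refine ⟨2 ^ j * (A' * C), fun z hz θ => ?_⟩
  have heq : (fun z' => iteratedFDeriv ℝ l (fun θ' => ρ z' • a (z', θ')) θ) =ᶠ[𝓝 z]
      fun z' => ρ z' • iteratedFDeriv ℝ l (fun θ' => a (z', θ')) θ := by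
    filter_upwards [hZ.mem_nhds (hKZ hz)] with z' hz'
    refine iteratedFDeriv_const_smul_apply' ?_
    have h1 : ContDiffAt ℝ ∞ a (z', θ) :=
      ha.1.contDiffAt ((hZ.prod isOpen_univ).mem_nhds ⟨hz', mem_univ _⟩)
    exact (h1.comp θ (f := fun θ' => (z', θ')) (by fun_prop)).of_le (by exact_mod_cast le_top)
  rw [(heq.iteratedFDeriv ℝ j).eq_of_nhds]
  have hsm : ContDiffOn ℝ ∞ (fun z' => iteratedFDeriv ℝ l (fun θ' => a (z', θ')) θ) Z :=
    (contDiffOn_iteratedFDeriv_snd hZ ha.1 l).comp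
      (contDiff_id.prodMk contDiff_const).contDiffOn fun z hz => ⟨hz, mem_univ _⟩
  refine (norm_iteratedFDeriv_smul_le_of_le hZ hρ.contDiffOn hsm (hKZ hz) hA0
    (fun i hi => (hA i z hz).trans (hA' i hi)) (fun i hi => hb z hz θ i hi) le_rfl).trans_eq ?_
  ring

end SymbolSmul

/-! ### Linearity of the reduced integrand -/

section Linearity

variable {E : Type*} [NormedAddCommGroup E] [NormedSpace ℝ E] {e : E} {f g : E → ℂ}

lemma iterate_oneSubLineDeriv_add (hf : ContDiff ℝ ∞ f) (hg : ContDiff ℝ ∞ g) (k : ℕ) :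
    (oneSubLineDeriv e)^[k] (f + g) = (oneSubLineDeriv e)^[k] f + (oneSubLineDeriv e)^[k] g := by
  induction k with
  | zero => rfl
  | succ k ih =>
    have h1 := (hf.iterate_oneSubLineDeriv (e := e) k).differentiable (by simp)
    have h2 := (hg.iterate_oneSubLineDeriv (e := e) k).differentiable (by simp)
    simp only [Function.iterate_succ_apply', ih]
    rw [oneSubLineDeriv_eq_fderiv h1, oneSubLineDeriv_eq_fderiv h2,
      oneSubLineDeriv_eq_fderiv (h1.add h2)]
    refine funext fun z => ?_
    rw [fderiv_add (h1 z) (h2 z)]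
    simp
    ring

lemma iterate_oneSubLineDeriv_const_smul (hf : ContDiff ℝ ∞ f) (r : ℝ) (k : ℕ) :
    (oneSubLineDeriv e)^[k] (r • f) = r • (oneSubLineDeriv e)^[k] f := by
  induction k with
  | zero => rfl
  | succ k ih =>
    have h1 := (hf.iterate_oneSubLineDeriv (e := e) k).differentiable (by simp)
    simp only [Function.iterate_succ_apply', ih]
    rw [oneSubLineDeriv_eq_fderiv h1, oneSubLineDeriv_eq_fderiv (h1.const_smul r)]
    refine funext fun z => ?_
    rw [fderiv_const_smul (h1 z)]
    simp
    ring

end Linearity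

/-! ### Distributions from bounded functionals -/

section Distributions

variable {E : Type*} [NormedAddCommGroup E] [NormedSpace ℝ E] {Ω : Opens E}

/-- On each compact set, `Λ` is bounded by the derivatives up to some order. -/
def IsLocallyBounded (Λ : 𝓓(Ω, ℝ) →ₗ[ℝ] ℂ) : Prop :=
  ∀ K : Set E, IsCompact K → K ⊆ Ω → ∃ k : ℕ, ∃ D : ℝ, 0 ≤ D ∧ ∀ w : 𝓓(Ω, ℝ), tsupport w ⊆ K →
    ∀ B, (∀ j ≤ k, ∀ z, ‖iteratedFDeriv ℝ j w z‖ ≤ B) → ‖Λ w‖ ≤ D * B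

/-- A locally bounded functional is a distribution. -/
def IsLocallyBounded.toDistribution {Λ : 𝓓(Ω, ℝ) →ₗ[ℝ] ℂ} (hΛ : IsLocallyBounded Λ) :
    𝓓'(Ω, ℂ) :=
  TestFunction.mkCLM ℝ Λ (map_add Λ) (map_smul Λ) fun K hKΩ => by
    obtain ⟨k, D, hD, h⟩ := hΛ K K.isCompact hKΩ
    refine (ContDiffMapSupportedIn.mkCLMtoNormedSpace ℝ
      (fun w => Λ (TestFunction.ofSupportedIn hKΩ w)) (fun f g =>
        Λ.map_add (TestFunction.ofSupportedIn hKΩ f) (TestFunction.ofSupportedIn hKΩ g))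
      (fun c f => Λ.map_smul c (TestFunction.ofSupportedIn hKΩ f)) ⟨Finset.Iic k, D, hD, fun w => ?_⟩).continuous
    refine h _ w.tsupport_subset _ fun j hj z => ?_
    refine (ContDiffMapSupportedIn.norm_iteratedFDeriv_apply_le_seminorm_top ℝ).trans ?_
    exact Seminorm.le_def.1 (Finset.le_sup (Finset.mem_Iic.2 hj)
      (f := fun i => ContDiffMapSupportedIn.seminorm ℝ E ℝ ⊤ K i)) w

@[simp] lemma IsLocallyBounded.toDistribution_apply {Λ : 𝓓(Ω, ℝ) →ₗ[ℝ] ℂ}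
    (hΛ : IsLocallyBounded Λ) (w : 𝓓(Ω, ℝ)) : hΛ.toDistribution w = Λ w := rfl

/-- The product of a test function with a smooth function. -/
def TestFunction.smoothMul {ρ : E → ℝ} (hρ : ContDiff ℝ ∞ ρ) : 𝓓(Ω, ℝ) →L[ℝ] 𝓓(Ω, ℝ) :=
  TestFunction.limitCLM ℝ
    (fun w => ⟨fun z => w z * ρ z, w.contDiff.mul hρ, w.hasCompactSupport.mul_right,
      (tsupport_mul_subset_left).trans w.tsupport_subset⟩)
    (fun _ hK => TestFunction.ofSupportedInCLM ℝ hK ∘L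
      ContDiffMapSupportedIn.bilinLeftCLM (ContinuousLinearMap.mul ℝ ℝ) hρ)
    fun _ _ _ => rfl

@[simp] lemma TestFunction.smoothMul_apply {ρ : E → ℝ} (hρ : ContDiff ℝ ∞ ρ) (w : 𝓓(Ω, ℝ))
    (z : E) : TestFunction.smoothMul hρ w z = w z * ρ z := rfl

end Distributions

/-! ### The oscillatory integral as a distribution -/

section OscillatoryDistribution

variable {m n : ℕ} {φ : PhaseDomain m n 1 → ℝ} {e : (Fin m → ℝ) × (Fin n → ℝ)}
  {Z : Opens ((Fin m → ℝ) × (Fin n → ℝ))} {a : PhaseDomain m n 1 → ℂ}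

lemma integrable_reducedIntegrand (ha : IsSymbol (Z : Set _) 2 a) (he : ‖e‖ ≤ 1)
    (hφ : ContDiff ℝ ∞ φ) (w : 𝓓(Z, ℝ)) : Integrable (reducedIntegrand e φ a w) := by
  have hsm := contDiff_smul_of_tsupport_subset Z.isOpen ha.1 w.contDiff w.tsupport_subset
  obtain ⟨C, -, hb⟩ := exists_norm_reducedIntegrand_le Z.isOpen ha he φ w.tsupport_subset
    w.hasCompactSupport
  obtain ⟨B, -, hB⟩ := exists_forall_norm_iteratedFDeriv_le w.contDiff w.hasCompactSupport 4
  exact (integrable_majorant w.hasCompactSupport (C * B)).mono'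
    (continuous_reducedIntegrand hφ hsm).aestronglyMeasurable
    (.of_forall (hb w w.contDiff subset_rfl B hB))

/-- The functional `w ↦ ∫ exp(i φ) a w`, as an oscillatory integral. -/
def oscillatoryFunctional (ha : IsSymbol (Z : Set _) 2 a) (he : ‖e‖ ≤ 1)
    (hφ : ContDiff ℝ ∞ φ) : 𝓓(Z, ℝ) →ₗ[ℝ] ℂ where
  toFun w := ∫ p, reducedIntegrand e φ a w p
  map_add' v w := by
    have hv := contDiff_smul_of_tsupport_subset Z.isOpen ha.1 v.contDiff v.tsupport_subset
    have hw := contDiff_smul_of_tsupport_subset Z.isOpen ha.1 w.contDiff w.tsupport_subset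
    rw [← integral_add (integrable_reducedIntegrand ha he hφ v)
      (integrable_reducedIntegrand ha he hφ w)]
    refine integral_congr_ae (.of_forall fun p => ?_)
    have : (fun p : PhaseDomain m n 1 => (v + w) p.1 • a p) =
        (fun p => v p.1 • a p) + fun p => w p.1 • a p := funext fun p => add_smul _ _ _
    simp only [reducedIntegrand, this, iterate_oneSubLineDeriv_add hv hw, Pi.add_apply]
    ring
  map_smul' r w := by
    have hw := contDiff_smul_of_tsupport_subset Z.isOpen ha.1 w.contDiff w.tsupport_subset
    rw [RingHom.id_apply, ← integral_smul]
    refine integral_congr_ae (.of_forall fun p => ?_)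
    have : (fun p : PhaseDomain m n 1 => (r • w) p.1 • a p) = r • fun p => w p.1 • a p :=
      funext fun p => smul_assoc r (w p.1) (a p)
    simp only [reducedIntegrand, this, iterate_oneSubLineDeriv_const_smul hw, Pi.smul_apply,
      mul_smul_comm]

lemma isLocallyBounded_oscillatoryFunctional (ha : IsSymbol (Z : Set _) 2 a) (he : ‖e‖ ≤ 1)
    (hφ : ContDiff ℝ ∞ φ) : IsLocallyBounded (oscillatoryFunctional ha he hφ) := fun K hK hKZ => by
  obtain ⟨D, hD, h⟩ := exists_norm_integral_reducedIntegrand_le Z.isOpen ha he φ hKZ hK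
  exact ⟨4, D, hD, fun w hw B hB => h w w.contDiff hw B hB⟩

lemma tendsto_oscillatoryFunctional (ha : IsSymbol (Z : Set _) 2 a) (he : ‖e‖ ≤ 1)
    (hφ : ContDiff ℝ ∞ φ) (hφe : ∀ p, fderiv ℝ φ p (e, 0) = -(p.2 0)) (w : 𝓓(Z, ℝ))
    {χ : (Fin 1 → ℝ) → ℝ} (hχ : IsFrequencyCutoff χ) :
    Tendsto (regularizedIntegral φ a χ w) (𝓝[>] 0) (𝓝 (oscillatoryFunctional ha he hφ w)) :=
  tendsto_regularizedIntegral Z.isOpen ha he hφ hφe w.contDiff w.hasCompactSupport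
    w.tsupport_subset hχ

end OscillatoryDistribution

/-! ### Operators with a given kernel -/

section Kernel

variable {m n : ℕ} {Y : Opens (Fin m → ℝ)} {X : Opens (Fin n → ℝ)}

lemma tsupport_tensor_subset (u : (Fin m → ℝ) → ℝ) (V : (Fin n → ℝ) → ℝ) :
    tsupport (fun z : (Fin m → ℝ) × (Fin n → ℝ) => u z.1 * V z.2) ⊆ tsupport u ×ˢ tsupport V :=
  closure_minimal (fun _ hz => ⟨subset_tsupport _ (left_ne_zero_of_mul hz),
    subset_tsupport _ (right_ne_zero_of_mul hz)⟩)
    ((isClosed_tsupport u).prod (isClosed_tsupport V))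

/-- The test function `u(y) V(x)`. -/
def tensor (u : 𝓓(Y, ℝ)) (V : 𝓓(X, ℝ)) : 𝓓(prodOpens Y X, ℝ) where
  toFun z := u z.1 * V z.2
  contDiff' := (u.contDiff.comp contDiff_fst).mul (V.contDiff.comp contDiff_snd)
  hasCompactSupport' := (u.hasCompactSupport.prod V.hasCompactSupport).of_isClosed_subset
    (isClosed_tsupport _) (tsupport_tensor_subset u V)
  tsupport_subset' := (tsupport_tensor_subset u V).trans
    (prod_mono u.tsupport_subset V.tsupport_subset)

@[simp] lemma tensor_apply (u : 𝓓(Y, ℝ)) (V : 𝓓(X, ℝ)) (z : (Fin m → ℝ) × (Fin n → ℝ)) :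
    tensor u V z = u z.1 * V z.2 := rfl

lemma norm_iteratedFDeriv_comp_clm_le {E F G : Type*} [NormedAddCommGroup E] [NormedSpace ℝ E]
    [NormedAddCommGroup F] [NormedSpace ℝ F] [NormedAddCommGroup G] [NormedSpace ℝ G] {g : F → G}
    (hg : ContDiff ℝ ∞ g) {L : E →L[ℝ] F} (hL : ‖L‖ ≤ 1) (j : ℕ) (z : E) :
    ‖iteratedFDeriv ℝ j (fun z => g (L z)) z‖ ≤ ‖iteratedFDeriv ℝ j g (L z)‖ := by
  have h := L.iteratedFDeriv_comp_right hg z (i := j) (by exact_mod_cast le_top)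
  rw [show (fun z => g (L z)) = g ∘ L from rfl, h]
  refine (ContinuousMultilinearMap.norm_compContinuousLinearMap_le _ _).trans ?_
  refine mul_le_of_le_one_right (norm_nonneg _) ?_
  exact Finset.prod_le_one (fun _ _ => norm_nonneg _) fun _ _ => hL

/-- The operator with kernel `Λ`: `V ↦ (u ↦ Λ (u ⊗ V))`. -/
def kernelFunctional (Λ : 𝓓(prodOpens Y X, ℝ) →ₗ[ℝ] ℂ) (V : 𝓓(X, ℝ)) : 𝓓(Y, ℝ) →ₗ[ℝ] ℂ where
  toFun u := Λ (tensor u V)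
  map_add' u v := by
    rw [← map_add]
    exact congrArg Λ (TestFunction.ext fun z => add_mul _ _ _)
  map_smul' r u := by
    rw [RingHom.id_apply, ← map_smul]
    exact congrArg Λ (TestFunction.ext fun z => mul_assoc _ _ _)

/-- For fixed `V`, the Leibniz rule bounds the derivatives of `u ⊗ V` by those of `u`; the
derivatives of `V` go into the constant. -/
lemma IsLocallyBounded.kernelFunctional {Λ : 𝓓(prodOpens Y X, ℝ) →ₗ[ℝ] ℂ}
    (hΛ : IsLocallyBounded Λ) (V : 𝓓(X, ℝ)) : IsLocallyBounded (kernelFunctional Λ V) := by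
  intro K hK hKY
  obtain ⟨k, D, hD, h⟩ := hΛ (K ×ˢ tsupport V) (hK.prod V.hasCompactSupport)
    (prod_mono hKY V.tsupport_subset)
  obtain ⟨A, hA, hVA⟩ := exists_forall_norm_iteratedFDeriv_le V.contDiff V.hasCompactSupport k
  refine ⟨k, D * (2 ^ k * A), by positivity, fun u hu B hB => ?_⟩
  have hB0 : 0 ≤ B := (norm_nonneg _).trans (hB 0 (Nat.zero_le _) 0)
  rw [mul_assoc]
  have h1 : ContDiff ℝ ∞ fun z : (Fin m → ℝ) × (Fin n → ℝ) => u z.1 :=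
    u.contDiff.comp contDiff_fst
  have h2 : ContDiff ℝ ∞ fun z : (Fin m → ℝ) × (Fin n → ℝ) => V z.2 :=
    V.contDiff.comp contDiff_snd
  have h3 (z : (Fin m → ℝ) × (Fin n → ℝ)) (i : ℕ) (hi : i ≤ k) :
      ‖iteratedFDeriv ℝ i (fun z : (Fin m → ℝ) × (Fin n → ℝ) => u z.1) z‖ ≤ B :=
    (norm_iteratedFDeriv_comp_clm_le u.contDiff
      (ContinuousLinearMap.norm_fst_le ℝ (Fin m → ℝ) (Fin n → ℝ)) i z).trans (hB i hi _)
  have h4 (z : (Fin m → ℝ) × (Fin n → ℝ)) (i : ℕ) (hi : i ≤ k) :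
      ‖iteratedFDeriv ℝ i (fun z : (Fin m → ℝ) × (Fin n → ℝ) => V z.2) z‖ ≤ A :=
    (norm_iteratedFDeriv_comp_clm_le V.contDiff
      (ContinuousLinearMap.norm_snd_le ℝ (Fin m → ℝ) (Fin n → ℝ)) i z).trans (hVA i hi _)
  have h5 (j : ℕ) (hj : j ≤ k) (z : (Fin m → ℝ) × (Fin n → ℝ)) :
      ‖iteratedFDeriv ℝ j (tensor u V) z‖ ≤ 2 ^ k * (B * A) :=
    norm_iteratedFDeriv_smul_le_of_le isOpen_univ h1.contDiffOn h2.contDiffOn (mem_univ z) hB0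
      (h3 z) (h4 z) hj
  exact (h (tensor u V) ((tsupport_tensor_subset u V).trans (prod_mono_left hu)) _ h5).trans_eq
    (by rw [mul_assoc, mul_comm A B])

/-- The operator with the locally bounded kernel `Λ`. -/
def kernelOperator {Λ : 𝓓(prodOpens Y X, ℝ) →ₗ[ℝ] ℂ} (hΛ : IsLocallyBounded Λ) :
    𝓓(X, ℝ) →ₗ[ℝ] 𝓓'(Y, ℂ) where
  toFun V := (hΛ.kernelFunctional V).toDistribution
  map_add' V W := ContinuousLinearMap.ext fun u => by
    refine Eq.trans ?_ (map_add Λ _ _)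
    exact congrArg Λ (TestFunction.ext fun z => mul_add _ _ _)
  map_smul' r V := ContinuousLinearMap.ext fun u => by
    refine Eq.trans ?_ (map_smul Λ _ _)
    exact congrArg Λ (TestFunction.ext fun z => mul_left_comm _ _ _)

lemma kernelOperator_apply {Λ : 𝓓(prodOpens Y X, ℝ) →ₗ[ℝ] ℂ} (hΛ : IsLocallyBounded Λ)
    (V : 𝓓(X, ℝ)) (u : 𝓓(Y, ℝ)) : kernelOperator hΛ V u = Λ (tensor u V) := rfl

end Kernel

/-! ### A smooth partition of unity by shells -/

section Shells

variable {m n : ℕ}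

/-- A smooth function of `x` that is `1` on the ball of radius `j + 1` and vanishes outside the
ball of radius `j + 2`. -/
def ballCutoff (n j : ℕ) : ContDiffBump (0 : Fin n → ℝ) where
  rIn := j + 1
  rOut := j + 2
  rIn_pos := by positivity
  rIn_lt_rOut := by linarith

/-- The differences of consecutive `ballCutoff`s, as functions of `(y, x)`. -/
def shell (m n : ℕ) : ℕ → (Fin m → ℝ) × (Fin n → ℝ) → ℝ
  | 0, z => ballCutoff n 0 z.2
  | j + 1, z => ballCutoff n (j + 1) z.2 - ballCutoff n j z.2

lemma contDiff_shell (j : ℕ) : ContDiff ℝ ∞ (shell m n j) := by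
  cases j with
  | zero => exact (ballCutoff n 0).contDiff.comp contDiff_snd
  | succ j =>
    exact ((ballCutoff n (j + 1)).contDiff.comp contDiff_snd).sub
      ((ballCutoff n j).contDiff.comp contDiff_snd)

lemma ballCutoff_eq_zero {j : ℕ} {x : Fin n → ℝ} (hx : (j : ℝ) + 2 ≤ ‖x‖) :
    ballCutoff n j x = 0 :=
  (ballCutoff n j).zero_of_le_dist (by rwa [dist_zero_right])

lemma ballCutoff_eq_one {j : ℕ} {x : Fin n → ℝ} (hx : ‖x‖ ≤ (j : ℝ) + 1) :
    ballCutoff n j x = 1 :=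
  (ballCutoff n j).one_of_mem_closedBall (by rwa [mem_closedBall_zero_iff])

lemma norm_le_of_shell_ne_zero {j : ℕ} {z : (Fin m → ℝ) × (Fin n → ℝ)} (hz : shell m n j z ≠ 0) :
    ‖z.2‖ ≤ j + 2 := by
  contrapose! hz
  cases j with
  | zero => exact ballCutoff_eq_zero hz.le
  | succ j =>
    push_cast at hz
    rw [shell, ballCutoff_eq_zero (by push_cast; linarith), ballCutoff_eq_zero (by linarith),
      sub_zero]

lemma shell_eq_zero {j : ℕ} (hj : j ≠ 0) {z : (Fin m → ℝ) × (Fin n → ℝ)} (hz : ‖z.2‖ ≤ j) :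
    shell m n j z = 0 := by
  obtain ⟨i, rfl⟩ := Nat.exists_eq_succ_of_ne_zero hj
  push_cast at hz
  rw [shell, ballCutoff_eq_one (by push_cast; linarith), ballCutoff_eq_one hz, sub_self]

lemma sum_shell (J : ℕ) (z : (Fin m → ℝ) × (Fin n → ℝ)) :
    ∑ j ∈ Finset.range (J + 1), shell m n j z = ballCutoff n J z.2 := by
  induction J with
  | zero => simp [shell]
  | succ J ih => rw [Finset.sum_range_succ, ih, shell, add_sub_cancel]

end Shells

/-! ### Lagrangian distributions from a global phase function -/

section Lagrangian

variable {m n : ℕ} {Y : Opens (Fin m → ℝ)} {X : Opens (Fin n → ℝ)} {μ : ℝ}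
  {C : Set (Cotangent m × Cotangent n)} {φ : PhaseDomain m n 1 → ℝ}
  {U : Set (PhaseDomain m n 1)} {a : PhaseDomain m n 1 → ℂ}

lemma hasConicSupportWithCompactBase_of_subset {K : Set ((Fin m → ℝ) × (Fin n → ℝ))}
    (hK : IsCompact K) (hKU : ∀ p : PhaseDomain m n 1, p.1 ∈ K → p.2 ≠ 0 → p ∈ U)
    (ha : ∀ p, a p ≠ 0 → p.1 ∈ K) : HasConicSupportWithCompactBase a U := by
  -- In one frequency variable the unit sphere is `{1, -1}`. Points with `ω = 0` are the apex,
  -- reached with `r = 0`.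
  refine ⟨K ×ˢ {fun _ => 1, fun _ => -1}, ?_, hK.prod (toFinite _).isCompact, fun p hp => ?_⟩
  · rintro p ⟨h1, h2⟩
    refine hKU p h1 fun h0 => ?_
    rcases h2 with h2 | h2 <;> simpa [h0] using congrFun h2 0
  · rcases le_total 0 (p.2 0) with h0 | h0
    · refine ⟨(p.1, fun _ => 1), ⟨ha p hp, Or.inl rfl⟩, p.2 0, h0, Prod.ext rfl ?_⟩
      ext i
      simp [Subsingleton.elim i 0]
    · refine ⟨(p.1, fun _ => -1), ⟨ha p hp, Or.inr rfl⟩, -p.2 0, by linarith, Prod.ext rfl ?_⟩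
      ext i
      simp [Subsingleton.elim i 0]

lemma regularizedIntegral_smul (ρ w : (Fin m → ℝ) × (Fin n → ℝ) → ℝ) (χ : (Fin 1 → ℝ) → ℝ) :
    regularizedIntegral φ (fun p => ρ p.1 • a p) χ w =
      regularizedIntegral φ a χ fun z => w z * ρ z := by
  refine funext fun ε => integral_congr_ae (.of_forall fun p => ?_)
  simp only [Complex.real_smul, Complex.ofReal_mul]
  ring

/-- An oscillatory integral whose amplitude is compactly supported in `y` is a Lagrangian
distribution: it is the sum of its pieces localized to shells in `x`. -/
lemma isLagrangianDistribution_of_isOscillatoryIntegral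
    (hUYX : ∀ p ∈ U, p.1 ∈ prodOpens Y X) (hφ : IsNondegeneratePhase φ U)
    (hC : DefinesOpenPiece φ U C)
    (ha : IsSymbol (prodOpens Y X : Set _) (μ + ((m : ℝ) + n) / 4 - ((1 : ℕ) : ℝ) / 2) a)
    {Q : Set (Fin m → ℝ)} (hQ : IsCompact Q) (haQ : ∀ p, a p ≠ 0 → p.1.1 ∈ Q)
    (hQU : ∀ p : PhaseDomain m n 1, p.1.1 ∈ Q → p.2 ≠ 0 → p ∈ U)
    {T : 𝓓'(prodOpens Y X, ℂ)} (hT : IsOscillatoryIntegral φ a T) :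
    IsLagrangianDistribution Y X μ C T := by
  have hvanish : ∀ Q' : Set ((Fin m → ℝ) × (Fin n → ℝ)), IsCompact Q' → ∃ J : ℕ, ∀ z ∈ Q',
      ‖z.2‖ ≤ J := fun Q' hQ' => by
    obtain ⟨R, hR⟩ := hQ'.isBounded.exists_norm_le
    obtain ⟨J, hJ⟩ := exists_nat_ge R
    exact ⟨J, fun z hz => (norm_snd_le z).trans ((hR z hz).trans hJ)⟩
  have hzero : ∀ (w : 𝓓(prodOpens Y X, ℝ)) (J : ℕ), (∀ z ∈ tsupport w, ‖z.2‖ ≤ J) →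
      ∀ j, J < j → TestFunction.smoothMul (contDiff_shell j) w = 0 := fun w J hJ j hj => by
    refine TestFunction.ext fun z => ?_
    rw [TestFunction.smoothMul_apply]
    by_cases hz : z ∈ tsupport w
    · rw [shell_eq_zero (by omega) ((hJ z hz).trans (by exact_mod_cast hj.le)), mul_zero]
      rfl
    · rw [image_eq_zero_of_notMem_tsupport hz, zero_mul]
      rfl
  -- Every piece keeps the phase. Cutting the amplitude by a shell amounts to multiplying the test
  -- function by it, so the pieces inherit their oscillatory integrals from `T`, and only finitely
  -- many meet a given compact set.
  refine ⟨fun _ => 1, fun _ => φ, fun j p => shell m n j p.1 • a p, fun _ => U,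
    fun j => ContinuousLinearMap.comp (T : 𝓓(prodOpens Y X, ℝ) →L[ℝ] ℂ)
      (TestFunction.smoothMul (contDiff_shell j)),
    fun j => ⟨hUYX, hφ, hC, ha.smul (prodOpens Y X).isOpen (contDiff_shell j), ?_, ?_⟩,
    fun Q' _ hQ' => ?_, fun w => ?_⟩
  · refine hasConicSupportWithCompactBase_of_subset
      (hQ.prod (isCompact_closedBall (0 : Fin n → ℝ) (j + 2))) (fun p hp => hQU p hp.1)
      fun p hp => ⟨haQ p (right_ne_zero_of_smul hp), ?_⟩
    rw [mem_closedBall_zero_iff]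
    exact norm_le_of_shell_ne_zero (left_ne_zero_of_smul hp)
  · intro w χ hχ
    rw [regularizedIntegral_smul]
    exact hT (TestFunction.smoothMul (contDiff_shell j) w) χ hχ
  · obtain ⟨J, hJ⟩ := hvanish Q' hQ'
    refine (finite_Iic J).subset fun j hj => ?_
    obtain ⟨w, hwQ, hw⟩ := hj
    by_contra hlt
    refine hw ?_
    have := hzero w J (fun z hz => hJ z (hwQ hz)) j (not_le.1 hlt)
    exact (congrArg T this).trans (map_zero T)
  · obtain ⟨J, hJ⟩ := hvanish (tsupport w) w.hasCompactSupport
    rw [finsum_eq_sum_of_support_subset (s := Finset.range (J + 1))]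
    · refine Eq.trans ?_ (map_sum T (fun j => TestFunction.smoothMul (contDiff_shell j) w) _)
      refine congrArg T (TestFunction.ext fun z => ?_)
      have hsum : (∑ j ∈ Finset.range (J + 1), TestFunction.smoothMul (contDiff_shell j) w) z =
          ∑ j ∈ Finset.range (J + 1), w z * shell m n j z := by
        simp
      rw [hsum, ← Finset.mul_sum, sum_shell]
      by_cases hz : z ∈ tsupport w
      · rw [ballCutoff_eq_one ((hJ z hz).trans (by linarith)), mul_one]
      · rw [image_eq_zero_of_notMem_tsupport hz, zero_mul]
    · intro j hj
      rw [Finset.coe_range, mem_Iio, Nat.lt_succ_iff]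
      by_contra hlt
      exact hj ((congrArg T (hzero w J hJ j (not_le.1 hlt))).trans (map_zero T))

end Lagrangian

/-! ### The forward operator as a Fourier integral operator. -/

namespace SAR

variable {α h : ℝ} {f : (Fin 2 → ℝ) → ℝ} {a₀ : PhaseDomain 2 2 1 → ℂ}

/-- The unit vector in the time direction. -/
def timeDirection : (Fin 2 → ℝ) × (Fin 2 → ℝ) := (Pi.single 1 1, 0)

lemma norm_timeDirection_le : ‖timeDirection‖ ≤ 1 := by
  simp only [timeDirection, Prod.norm_def, norm_zero]
  exact max_le ((pi_norm_le_iff_of_nonneg zero_le_one).2 fun i => by fin_cases i <;> simp)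
    zero_le_one

lemma fderiv_phase_timeDirection (hh : 0 < h) (α : ℝ) (p : PhaseDomain 2 2 1) :
    fderiv ℝ (phase α h) p (timeDirection, 0) = -(p.2 0) := by
  rw [fderiv_phase_apply hh, fderiv_range_apply hh]
  simp [timeDirection]

/-- The kernel comes first, as a distribution on `Y × X`; the operator is defined by its values on
tensor products. The support of `f` keeps the nonzero-frequency part of the amplitude inside
`phaseCone`. -/
theorem exists_forward_operator (hh : 0 < h) (α : ℝ) (hf : IsDataCutoff α h f)
    (ha : IsSymbol (prodOpens dataSpace objectSpace : Set _) 2 (amplitude f a₀)) :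
    ∃ A : 𝓓(objectSpace, ℝ) →ₗ[ℝ] 𝓓'(dataSpace, ℂ),
      IsOscillatoryIntegralOperator (phase α h) (amplitude f a₀) A ∧
      IsFourierIntegralOperator (3 / 2) (relation α h) A := by
  have hΛ := isLocallyBounded_oscillatoryFunctional ha norm_timeDirection_le (contDiff_phase hh α)
  have htend := fun w χ hχ => tendsto_oscillatoryFunctional ha norm_timeDirection_le
    (contDiff_phase hh α) (fderiv_phase_timeDirection hh α) w (χ := χ) hχ
  refine ⟨kernelOperator hΛ, fun V u χ hχ => htend (tensor u V) χ hχ,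
    isCanonicalRelation_relation hh α, hΛ.toDistribution, ?_, fun V u w hw => ?_⟩
  · refine isLagrangianDistribution_of_isOscillatoryIntegral (Y := dataSpace) (X := objectSpace)
      (U := phaseCone α h)
      (fun p hp => ⟨signalRegion_subset α h hp.1, mem_univ _⟩) (isNondegeneratePhase_phase hh α)
      (definesOpenPiece_phase hh α) ?_ hf.hasCompactSupport (fun p hp => ?_)
      (fun p hp h0 => ⟨hf.tsupport_subset hp, h0⟩) htend
    -- The order count: `3/2 + (2 + 2)/4 - 1/2 = 2`.
    · convert ha using 1
      norm_num
    · refine subset_tsupport _ fun h0 => hp ?_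
      rw [amplitude, h0, Complex.ofReal_zero, zero_mul]
  · rw [kernelOperator_apply, hΛ.toDistribution_apply]
    exact congrArg _ (TestFunction.ext fun z => hw z.1 z.2)

end SAR

end

theorem mainTheorem1 (α h : ℝ) (hα : 0 ≤ α) (hh : 0 < h)
    (f : (Fin 2 → ℝ) → ℝ) (hf : SAR.IsDataCutoff α h f)
    (a₀ : PhaseDomain 2 2 1 → ℂ)
    (ha : IsSymbol (prodOpens SAR.dataSpace SAR.objectSpace : Set _) 2 (SAR.amplitude f a₀)) :
    -- the forward operator is well defined and is an FIO of order `3/2`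
    (∃ A : 𝓓(SAR.objectSpace, ℝ) →ₗ[ℝ] 𝓓'(SAR.dataSpace, ℂ),
      IsOscillatoryIntegralOperator (SAR.phase α h) (SAR.amplitude f a₀) A ∧
      IsFourierIntegralOperator (3 / 2) (SAR.relation α h) A) ∧
    -- its canonical relation is the explicit one, globally parametrized by `(s, x₁, x₂, ω)`
    (phaseRelation (SAR.phase α h) (SAR.phaseCone α h) = SAR.relation α h ∧
      SAR.relation α h ⊆ puncturedCotangentProd SAR.dataSpace SAR.objectSpace ∧
      IsSmoothParametrization (SAR.param α h) (SAR.paramDomain α) (SAR.relation α h)) ∧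
    -- both projections drop rank simply by one exactly on `Σ₁`
    (DropsRankByOneSimply (SAR.projL α h) (SAR.paramDomain α) (SAR.sigmaOne α) ∧
      DropsRankByOneSimply (SAR.projR α h) (SAR.paramDomain α) (SAR.sigmaOne α)) ∧
    -- fold on the left, blowdown on the right
    (HasWhitneyFold (SAR.projL α h) (SAR.paramDomain α) (SAR.sigmaOne α) ∧
      HasBlowdown (SAR.projR α h) (SAR.paramDomain α) (SAR.sigmaOne α)) := by
  exact ⟨SAR.exists_forward_operator hh α hf ha,
    ⟨SAR.phaseRelation_phase hh α, SAR.relation_subset hh α, SAR.isSmoothParametrization_param hh α⟩,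
    ⟨SAR.dropsRankByOneSimply_projL hα hh, SAR.dropsRankByOneSimply_projR hα hh⟩,
    SAR.hasWhitneyFold_projL hα hh, SAR.hasBlowdown_projR hα hh⟩
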